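/- Let $n\ge 1$, $1<p<\infty$, $0<\alpha<\frac np$, $0<q<p-1$, and let $M^+(\mathbb R^n)$ be the set of nonnegative, locally finite Borel measures on $\mathbb R^n$. For a nonnegative Borel measure $\nu$ put $$\mathbf W\nu(x)=\int_0^\infty\Big[\frac{\nu(B(x,t))}{t^{n-\alpha p}}\Big]^{\frac1{p-1}}\frac{dt}{t}\in[0,\infty],\qquad x\in\mathbb R^n .$$ For $\sigma\in M^+(\mathbb R^n)$ and a Borel set $E$ let $\kappa(E)\in[0,\infty]$ be the least constant in $$\Big(\int_E(\mathbf W\nu)^q\,d\sigma\Big)^{1/q}\le\kappa(E)\,\nu(\mathbb R^n)^{\frac1{p-1}}\qquad\text{for all }\nu\in M^+(\mathbb R^n),$$ and put $$\mathbf K\sigma(x)=\int_0^\infty\Big[\frac{\kappa(B(x,t))^{\frac{q(p-1)}{p-1-q}}}{t^{n-\alpha p}}\Big]^{\frac1{p-1}}\frac{dt}{t}.$$ Let $\sigma,\mu\in M^+(\mathbb R^n)$ and let $u:\mathbb R^n\to[0,\infty]$ be $\sigma$-measurable with $u<\infty$ $\sigma$-a.e. Call $u$ a *solution* if $u=\mathbf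 W(u^q\,d\sigma)+\mathbf W\mu$ at every point of $\mathbb R^n$, a *supersolution* if $u\ge\mathbf W(u^q\,d\sigma)+\mathbf W\mu$ $\sigma$-a.e., and a *subsolution* if $u\le\mathbf W(u^q\,d\sigma)+\mathbf W\mu$ $\sigma$-a.e. Call the pair $(u,\mu)$ *nontrivial* if $\mu\ne0$ or $u$ is not $\sigma$-a.e. equal to $0$. Say that a property holds q.e. if it holds outside a set $E$ with $\operatorname{cap}_{\alpha,p}(E)=0$, where $\operatorname{cap}_{\alpha,p}(E)=\inf\{\|f\|_{L^p(\mathbb R^n)}^p: f\ge0 \text{ measurable},\ \int\frac{f(y)\,dy}{|x-y|^{n-\alpha}}\ge1\ \text{for all } x\in E\}$. **Theorem.** There are constants $C_1,C_2>0$ depending only on $p,q,\alpha,n$ such that for all $\sigma,\mu\in M^+(\mathbb R^n)$ the following holds for the inequalities $$\text{(L)}\quad C_1\Big[(\mathbf W\sigma(x))^{\frac{p-1}{p-1-q}}+\mathbf K\sigma(x)+\mathbf W\mu(x)\Big]\le u(x),\qquad \text{(U)}\quad u(x)\le C_2\Big[(\mathbf W\sigma(x))^{\frac{p-1}{p-1-q}}+\mathbf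 K\sigma(x)+\mathbf W\mu(x)\Big].$$ 1. If $u$ is a solution, then (L) holds at every $x\in\mathbb R^n$ provided $(u,\mu)$ is nontrivial; and (U) holds at every $x$ with $u(x)<\infty$, as well as $\sigma$-a.e. and q.e. 2. If $u$ is a supersolution and $(u,\mu)$ is nontrivial, then (L) holds at every $x$ such that $\mathbf W(u^q\,d\sigma)(x)+\mathbf W\mu(x)\le u(x)<\infty$. 3. If $u$ is a subsolution, then (U) holds at every $x$ such that $u(x)\le\mathbf W(u^q\,d\sigma)(x)+\mathbf W\mu(x)<\infty$. -/

import Mathlib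

open MeasureTheory
open scoped ENNReal

noncomputable section

/-- The Havin-Maz'ya-Wolff potential `∫₀^∞ [ν(B(x,t)) / t^(n - αp)]^(1/(p-1)) dt/t`, with values
in `[0,∞]`. -/
def wolffPotential {n : ℕ} (α p : ℝ) (ν : Measure (EuclideanSpace ℝ (Fin n)))
    (x : EuclideanSpace ℝ (Fin n)) : ℝ≥0∞ :=
  ∫⁻ t in Set.Ioi (0 : ℝ),
    (ν (Metric.ball x t) / ENNReal.ofReal (t ^ ((n : ℝ) - α * p))) ^ (1 / (p - 1)) /
      ENNReal.ofReal t

/-- The least constant `κ(E)` in the inequality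
`‖W ν‖_{L^q(σ|_E)} ≤ κ(E) · ν(ℝⁿ)^(1/(p-1))`, for all locally finite Borel measures `ν` on `ℝⁿ`
(it is `∞` if there is no finite constant). -/
def embeddingConst {n : ℕ} (α p q : ℝ) (σ : Measure (EuclideanSpace ℝ (Fin n)))
    (E : Set (EuclideanSpace ℝ (Fin n))) : ℝ≥0∞ :=
  sInf {k : ℝ≥0∞ | ∀ ν : Measure (EuclideanSpace ℝ (Fin n)), IsLocallyFiniteMeasure ν →
    (∫⁻ y, wolffPotential α p ν y ^ q ∂(σ.restrict E)) ^ (1 / q) ≤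
      k * ν Set.univ ^ (1 / (p - 1))}

/-- The intrinsic potential
`K σ (x) = ∫₀^∞ [κ(B(x,t))^(q(p-1)/(p-1-q)) / t^(n - αp)]^(1/(p-1)) dt/t`. -/
def intrinsicPotential {n : ℕ} (α p q : ℝ) (σ : Measure (EuclideanSpace ℝ (Fin n)))
    (x : EuclideanSpace ℝ (Fin n)) : ℝ≥0∞ :=
  ∫⁻ t in Set.Ioi (0 : ℝ),
    (embeddingConst α p q σ (Metric.ball x t) ^ (q * (p - 1) / (p - 1 - q)) /
        ENNReal.ofReal (t ^ ((n : ℝ) - α * p))) ^ (1 / (p - 1)) /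
      ENNReal.ofReal t

/-- The right-hand side `W(u^q dσ) + W μ` of the integral equation. -/
def wolffRHS {n : ℕ} (α p q : ℝ) (σ μ : Measure (EuclideanSpace ℝ (Fin n)))
    (u : EuclideanSpace ℝ (Fin n) → ℝ≥0∞) (x : EuclideanSpace ℝ (Fin n)) : ℝ≥0∞ :=
  wolffPotential α p (σ.withDensity fun y => u y ^ q) x + wolffPotential α p μ x

/-- A nonnegative solution of `u = W(u^q dσ) + W μ`: the equation holds (in `[0,∞]`) at every
point of `ℝⁿ`, and `u` is finite `σ`-a.e. -/
structure IsWolffSolution {n : ℕ} (α p q : ℝ) (σ μ : Measure (EuclideanSpace ℝ (Fin n)))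
    (u : EuclideanSpace ℝ (Fin n) → ℝ≥0∞) : Prop where
  aemeasurable : AEMeasurable u σ
  eq_rhs : ∀ x, u x = wolffRHS α p q σ μ u x
  ae_finite : ∀ᵐ x ∂σ, u x < ∞

/-- A nonnegative supersolution: `W(u^q dσ) + W μ ≤ u < ∞` holds `σ`-a.e. -/
structure IsWolffSupersolution {n : ℕ} (α p q : ℝ) (σ μ : Measure (EuclideanSpace ℝ (Fin n)))
    (u : EuclideanSpace ℝ (Fin n) → ℝ≥0∞) : Prop where
  aemeasurable : AEMeasurable u σ
  ae_rhs_le : ∀ᵐ x ∂σ, wolffRHS α p q σ μ u x ≤ u x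
  ae_finite : ∀ᵐ x ∂σ, u x < ∞

/-- A nonnegative subsolution: `u ≤ W(u^q dσ) + W μ` and `u < ∞` hold `σ`-a.e. -/
structure IsWolffSubsolution {n : ℕ} (α p q : ℝ) (σ μ : Measure (EuclideanSpace ℝ (Fin n)))
    (u : EuclideanSpace ℝ (Fin n) → ℝ≥0∞) : Prop where
  aemeasurable : AEMeasurable u σ
  ae_le_rhs : ∀ᵐ x ∂σ, u x ≤ wolffRHS α p q σ μ u x
  ae_finite : ∀ᵐ x ∂σ, u x < ∞

/-- The expression `(W σ)^((p-1)/(p-1-q)) + K σ + W μ`. -/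
def wolffBound {n : ℕ} (α p q : ℝ) (σ μ : Measure (EuclideanSpace ℝ (Fin n)))
    (x : EuclideanSpace ℝ (Fin n)) : ℝ≥0∞ :=
  wolffPotential α p σ x ^ ((p - 1) / (p - 1 - q)) + intrinsicPotential α p q σ x +
    wolffPotential α p μ x

/-- The Riesz potential `I_α f (x) = ∫ f(y) / |x - y|^(n - α) dy` of a nonnegative function. -/
def rieszPotential {n : ℕ} (α : ℝ) (f : EuclideanSpace ℝ (Fin n) → ℝ≥0∞)
    (x : EuclideanSpace ℝ (Fin n)) : ℝ≥0∞ :=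
  ∫⁻ y, f y / ENNReal.ofReal (dist x y ^ ((n : ℝ) - α))

/-- The Riesz capacity
`cap_{α,p}(E) = inf {‖f‖_p^p : f ≥ 0 measurable, I_α f ≥ 1 on E}`. -/
def rieszCapacity {n : ℕ} (α p : ℝ) (E : Set (EuclideanSpace ℝ (Fin n))) : ℝ≥0∞ :=
  ⨅ (f : EuclideanSpace ℝ (Fin n) → ℝ≥0∞) (_ : Measurable f)
    (_ : ∀ x ∈ E, 1 ≤ rieszPotential α f x), ∫⁻ y, f y ^ p

/-- A property holds `(α,p)`-quasi-everywhere: it fails only on a set of capacity zero. -/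
def QuasiEverywhere {n : ℕ} (α p : ℝ) (P : EuclideanSpace ℝ (Fin n) → Prop) : Prop :=
  rieszCapacity α p {x | ¬ P x} = 0

end

/-! Put `s = 1/(p-1)`, `γ = q/(p-1) < 1`, `d = n - αp`, `ω = u^q dσ`. Up to constants, `Wν(x)` is
the sum over `k ∈ ℤ` of the terms `a_k = (ν(B(x,2^k)) / 2^(dk))^s`. The tails `T_k = ∑_{j ≥ k} a_j`
hardly change when the centre moves by less than `2^k`, and this carries both bounds.

Lower bound. On `B(x,2^k)` a supersolution satisfies `u ≥ Wω ≥ c T_k`, so `ω(B) ≥ c T_k^q σ(B)`.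
Summing the resulting terms `a_k T_k^(-γ)`, a discrete `∫ T^(-γ) dT`, gives `Wσ ≤ C (Wω)^(1-γ)`
(`exists_dyadicWolff_le_rpow`). For `Kσ`, any `ν` satisfies `Wν ≤ C (M_ω ν)^s Wω ≤ C (M_ω ν)^s u`,
with `M_ω` the centred maximal operator. The weak (1,1) bound (Besicovitch) and Kolmogorov's
inequality for the exponent `γ < 1` then bound a power of `κ(A)` by `ω(A)`
(`exists_embeddingConst_rpow_le`).

Upper bound. Let `θ = ω + μ`. On `B(x,2^k)` a subsolution is at most a multiple of the potential of
`θ` restricted to the doubled ball, controlled by `κ`, plus `T_k` (`exists_measure_ball_le`).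
Young's inequality leaves a small multiple of the sum for `θ`, which is absorbed since `Wω(x) < ∞`
(`exists_wolffRHS_le`).

Quasi-everywhere. If `Wθ` is finite somewhere, the set `{Wθ = ∞}` has capacity zero: for finite `θ`,
the function `sup_k 2^(-αk) a_k (1 + T_k)^(-δ)` with `1/p < δ < 1` lies in `L^p` and has infinite
Riesz potential there; the general case follows by localisation. -/

/-! ### Young's and Kolmogorov's inequalities in `[0,∞]`. -/

theorem ENNReal.add_rpow_le_two_rpow_mul (a b : ℝ≥0∞) {r : ℝ} (hr : 0 ≤ r) :
    (a + b) ^ r ≤ 2 ^ r * (a ^ r + b ^ r) := by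
  have h : a + b ≤ 2 * max a b := by
    rw [two_mul]; exact add_le_add (le_max_left _ _) (le_max_right _ _)
  calc (a + b) ^ r ≤ (2 * max a b) ^ r := ENNReal.rpow_le_rpow h hr
    _ = 2 ^ r * (max a b) ^ r := ENNReal.mul_rpow_of_nonneg _ _ hr
    _ ≤ 2 ^ r * (a ^ r + b ^ r) := by
      gcongr
      rcases le_total a b with h | h
      · rw [max_eq_right h]; exact le_add_self
      · rw [max_eq_left h]; exact le_self_add

/-- Either `a ≤ ε b^(1-γ)` and the first term dominates, or solving for `b` shows that the second
does; infinite `a`, `b` need no separate treatment. -/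
theorem ENNReal.mul_rpow_le_young (a b ε : ℝ≥0∞) {γ : ℝ} (h0 : 0 < γ) (h1 : γ < 1)
    (hε : ε ≠ 0) (hε' : ε ≠ ∞) :
    a * b ^ γ ≤ ε * b + ε⁻¹ ^ (γ / (1 - γ)) * a ^ (1 / (1 - γ)) := by
  have h1' : 0 < 1 - γ := by linarith
  rcases le_total a (ε * b ^ (1 - γ)) with h | h
  · calc a * b ^ γ ≤ ε * b ^ (1 - γ) * b ^ γ := by gcongr
      _ = ε * b := by
        rw [mul_assoc, ← ENNReal.rpow_add_of_nonneg _ _ h1'.le h0.le]; simp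
      _ ≤ _ := le_self_add
  · have hb : b ^ (1 - γ) ≤ ε⁻¹ * a := by
      rw [mul_comm, ← div_eq_mul_inv, ENNReal.le_div_iff_mul_le (Or.inl hε) (Or.inl hε'), mul_comm]
      exact h
    have hb' : b ^ γ ≤ (ε⁻¹ * a) ^ (γ / (1 - γ)) := by
      calc b ^ γ = (b ^ (1 - γ)) ^ (γ / (1 - γ)) := by
            rw [← ENNReal.rpow_mul]; congr 1; field_simp
        _ ≤ _ := ENNReal.rpow_le_rpow hb (by positivity)
    calc a * b ^ γ ≤ a * (ε⁻¹ * a) ^ (γ / (1 - γ)) := by gcongr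
      _ = ε⁻¹ ^ (γ / (1 - γ)) * (a ^ (1 : ℝ) * a ^ (γ / (1 - γ))) := by
        rw [ENNReal.mul_rpow_of_nonneg _ _ (by positivity), ENNReal.rpow_one]; ring
      _ = ε⁻¹ ^ (γ / (1 - γ)) * a ^ (1 / (1 - γ)) := by
        rw [← ENNReal.rpow_add_of_nonneg _ _ zero_le_one (by positivity)]
        congr 2; field_simp; ring
      _ ≤ _ := le_add_self

/-- For `0 < g < ∞` the largest power of two strictly below `g` suffices; for `g = ∞` all terms with
`i ≥ 0` are at least 1. -/
theorem ENNReal.rpow_le_tsum_two_zpow {r : ℝ} (hr : 0 < r) (g : ℝ≥0∞) :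
    g ^ r ≤ 2 ^ r * ∑' i : ℤ, if (2 : ℝ≥0∞) ^ i < g then ((2 : ℝ≥0∞) ^ i) ^ r else 0 := by
  rcases eq_or_ne g 0 with rfl | h0
  · simp [ENNReal.zero_rpow_of_pos hr]
  rcases eq_or_ne g ∞ with rfl | htop
  · have : ∑' i : ℤ, (if (2 : ℝ≥0∞) ^ i < ∞ then ((2 : ℝ≥0∞) ^ i) ^ r else 0) = ∞ := by
      refine top_unique ?_
      refine le_trans (ENNReal.tsum_const_eq_top_of_ne_zero (α := ℕ) one_ne_zero).ge ?_
      refine le_trans ?_ (ENNReal.tsum_comp_le_tsum_of_injective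
        (f := fun n : ℕ => (n : ℤ)) Nat.cast_injective _)
      refine ENNReal.tsum_le_tsum fun n => ?_
      have hlt : (2 : ℝ≥0∞) ^ (n : ℤ) < ∞ := by
        rw [zpow_natCast]; exact ENNReal.pow_lt_top ENNReal.ofNat_lt_top
      rw [if_pos hlt, zpow_natCast]
      exact ENNReal.one_le_rpow (one_le_pow₀ (by norm_num)) hr
    rw [this, ENNReal.mul_top (by simp)]
    exact le_top
  · obtain ⟨i, hi, hi'⟩ := ENNReal.exists_mem_Ioc_zpow h0 htop (y := 2) (by norm_num) (by simp)
    calc g ^ r ≤ (2 ^ (i + 1)) ^ r := ENNReal.rpow_le_rpow hi' hr.le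
      _ = 2 ^ r * (2 ^ i) ^ r := by
        rw [ENNReal.zpow_add (by simp) (by simp), zpow_one, mul_comm,
          ENNReal.mul_rpow_of_nonneg _ _ hr.le]
      _ ≤ _ := by
        gcongr
        refine le_trans ?_ (ENNReal.le_tsum i)
        rw [if_pos hi]

theorem lintegral_rpow_le_tsum_two_zpow {X : Type*} [MeasurableSpace X] (m : Measure X)
    {g : X → ℝ≥0∞} (hg : Measurable g) {r : ℝ} (hr : 0 < r) :
    ∫⁻ x, g x ^ r ∂m ≤
      2 ^ r * ∑' i : ℤ, ((2 : ℝ≥0∞) ^ i) ^ r * m {x | (2 : ℝ≥0∞) ^ i < g x} := by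
  have hs : ∀ i : ℤ, MeasurableSet {x | (2 : ℝ≥0∞) ^ i < g x} := fun i =>
    measurableSet_lt measurable_const hg
  calc ∫⁻ x, g x ^ r ∂m
      ≤ ∫⁻ x, 2 ^ r * ∑' i : ℤ, {x | (2 : ℝ≥0∞) ^ i < g x}.indicator
          (fun _ => ((2 : ℝ≥0∞) ^ i) ^ r) x ∂m := by
        refine lintegral_mono fun x => (ENNReal.rpow_le_tsum_two_zpow hr (g x)).trans ?_
        simp only [Set.indicator, Set.mem_ofPred_eq]
        exact le_rfl
    _ = _ := by
        rw [lintegral_const_mul' _ _ (ENNReal.rpow_ne_top_of_nonneg hr.le (by simp)),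
          lintegral_tsum fun i => (measurable_const.indicator (hs i)).aemeasurable]
        congr 2
        ext i
        rw [lintegral_indicator_const (hs i)]

theorem tsum_int_two_zpow_rpow_ne_top {r : ℝ} (hr : 0 < r) :
    ∑' n : ℕ, ((2 : ℝ≥0∞) ^ (-((n : ℤ) + 1))) ^ r ≠ ∞ := by
  have h : ∀ n : ℕ, ((2 : ℝ≥0∞) ^ (-((n : ℤ) + 1))) ^ r ≤ ((2 : ℝ≥0∞) ^ (-r)) ^ n := fun n => by
    rw [← ENNReal.rpow_intCast, ← ENNReal.rpow_natCast, ← ENNReal.rpow_mul, ← ENNReal.rpow_mul]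
    apply ENNReal.rpow_le_rpow_of_exponent_le (by norm_num)
    push_cast; nlinarith
  refine ne_top_of_le_ne_top ?_ (ENNReal.tsum_le_tsum h)
  rw [ENNReal.tsum_geometric, ENNReal.inv_ne_top]
  exact (tsub_pos_of_lt (ENNReal.rpow_lt_one_of_one_lt_of_neg (by norm_num) (by linarith))).ne'

/-- Kolmogorov's inequality. Low levels use the trivial bound `m(X)`, high levels the weak bound
`A/t`; both geometric series converge because `0 < γ < 1`. -/
theorem exists_lintegral_rpow_le_of_weak {γ : ℝ} (h0 : 0 < γ) (h1 : γ < 1) :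
    ∃ C : ℝ≥0∞, C ≠ ∞ ∧ ∀ (X : Type) [MeasurableSpace X] (m : Measure X) (f : X → ℝ≥0∞)
      (_ : Measurable f) (A : ℝ≥0∞), (∀ t, t ≠ 0 → t ≠ ∞ → t * m {x | t < f x} ≤ A) →
        ∫⁻ x, f x ^ γ ∂m ≤ C * (A ^ γ * m Set.univ ^ (1 - γ)) := by
  have h1' : 0 < 1 - γ := by linarith
  set S : ℝ≥0∞ := ∑' i : ℤ, ((2 : ℝ≥0∞) ^ i) ^ γ * min 1 ((2 : ℝ≥0∞) ^ i)⁻¹ with hS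
  have hSfin : S ≠ ∞ := by
    rw [hS, tsum_of_nat_of_neg_add_one ENNReal.summable ENNReal.summable, ENNReal.add_ne_top]
    constructor
    · have h : ∀ n : ℕ, ((2 : ℝ≥0∞) ^ (n : ℤ)) ^ γ * min 1 ((2 : ℝ≥0∞) ^ (n : ℤ))⁻¹
          ≤ ((2 : ℝ≥0∞) ^ (γ - 1)) ^ n := fun n => by
        calc _ ≤ ((2 : ℝ≥0∞) ^ (n : ℤ)) ^ γ * ((2 : ℝ≥0∞) ^ (n : ℤ))⁻¹ := by
              gcongr; exact min_le_right _ _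
          _ = _ := by
            rw [← ENNReal.rpow_intCast, ← ENNReal.rpow_natCast, ← ENNReal.rpow_mul,
              ← ENNReal.rpow_mul, ← ENNReal.rpow_neg, ← ENNReal.rpow_add _ _ (by simp) (by simp)]
            congr 1; push_cast; ring
      refine ne_top_of_le_ne_top ?_ (ENNReal.tsum_le_tsum h)
      rw [ENNReal.tsum_geometric, ENNReal.inv_ne_top]
      exact (tsub_pos_of_lt
        (ENNReal.rpow_lt_one_of_one_lt_of_neg (by norm_num) (by linarith))).ne'
    · refine ne_top_of_le_ne_top (tsum_int_two_zpow_rpow_ne_top h0)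
        (ENNReal.tsum_le_tsum fun n => ?_)
      calc _ ≤ ((2 : ℝ≥0∞) ^ (-((n : ℤ) + 1))) ^ γ * 1 := by gcongr; exact min_le_left _ _
        _ = _ := mul_one _
  refine ⟨2 ^ γ * S, ENNReal.mul_ne_top (ENNReal.rpow_ne_top_of_nonneg h0.le (by simp)) hSfin, ?_⟩
  intro X _ m f hf A hA
  rcases eq_or_ne (m Set.univ) 0 with hm0 | hm0
  · rw [Measure.measure_univ_eq_zero] at hm0
    simp [hm0]
  rcases eq_or_ne A 0 with rfl | hA0
  · have : ∀ᵐ x ∂m, f x = 0 := by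
      have hk : ∀ n : ℕ, m {x | ((n : ℝ≥0∞) + 1)⁻¹ < f x} = 0 := fun n => by
        have := hA ((n : ℝ≥0∞) + 1)⁻¹ (by simp) (by simp)
        simpa using this
      have := measure_iUnion_null hk
      refine measure_mono_null (fun x hx => ?_) this
      obtain ⟨n, hn⟩ := ENNReal.exists_inv_nat_lt (show f x ≠ 0 from hx)
      refine Set.mem_iUnion.2 ⟨n, lt_of_le_of_lt ?_ hn⟩
      exact ENNReal.inv_le_inv.2 le_self_add
    rw [lintegral_congr_ae (g := fun _ => 0) (by
      filter_upwards [this] with x hx; simp [hx, h0])]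
    simp
  rcases eq_or_ne (m Set.univ) ∞ with hmt | hmt
  · rcases eq_or_ne S 0 with hS0 | hS0
    · exfalso
      have := ENNReal.tsum_eq_zero.1 hS0 0
      simp at this
    · rw [hmt, ENNReal.top_rpow_of_pos h1', ENNReal.mul_top, ENNReal.mul_top]
      · exact le_top
      · simp [hS0]
      · simp [ENNReal.rpow_eq_zero_iff, hA0, h0.le]
  rcases eq_or_ne A ∞ with rfl | hAt
  · have hS0 : S ≠ 0 := fun hS0 => by
      have := ENNReal.tsum_eq_zero.1 hS0 0
      simp at this
    rw [ENNReal.top_rpow_of_pos h0, ENNReal.top_mul, ENNReal.mul_top]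
    · exact le_top
    · simp [hS0]
    · simp [ENNReal.rpow_eq_zero_iff, hm0, h1.le]
  -- The level at which the bounds `m(X)` and `A/t` cross; all levels are measured in this unit.
  set L := A / m Set.univ with hL
  have hL0 : L ≠ 0 := by simp [hL, ENNReal.div_eq_zero_iff, hA0, hmt]
  have hLt : L ≠ ∞ := ENNReal.div_ne_top hAt hm0
  have hb : ∀ i : ℤ, m {x | (2 : ℝ≥0∞) ^ i < f x / L} ≤
      m Set.univ * min 1 ((2 : ℝ≥0∞) ^ i)⁻¹ := fun i => by
    have h2 : (2 : ℝ≥0∞) ^ i ≠ 0 := (ENNReal.zpow_pos (by simp) (by simp) i).ne'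
    have h2' : (2 : ℝ≥0∞) ^ i ≠ ∞ := (ENNReal.zpow_lt_top (by simp) (by simp) i).ne
    rw [mul_min, mul_one]
    refine le_min (measure_mono (Set.subset_univ _)) ?_
    have hset : {x | (2 : ℝ≥0∞) ^ i < f x / L} = {x | (2 : ℝ≥0∞) ^ i * L < f x} := by
      ext x
      simp only [Set.mem_ofPred_eq]
      rw [ENNReal.lt_div_iff_mul_lt (Or.inl hL0) (Or.inl hLt)]
    rw [hset]
    have := hA ((2 : ℝ≥0∞) ^ i * L) (mul_ne_zero h2 hL0) (ENNReal.mul_ne_top h2' hLt)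
    rw [mul_comm, ← ENNReal.le_div_iff_mul_le (Or.inl (mul_ne_zero h2 hL0))
      (Or.inl (ENNReal.mul_ne_top h2' hLt))] at this
    refine this.trans (le_of_eq ?_)
    have hAL : A = L * m Set.univ := (ENNReal.div_mul_cancel hm0 hmt).symm
    rw [hAL, mul_comm _ L, ENNReal.mul_div_mul_left _ _ hL0 hLt, div_eq_mul_inv]
  have hf' : ∀ x, f x ^ γ = L ^ γ * (f x / L) ^ γ := fun x => by
    rw [← ENNReal.mul_rpow_of_nonneg _ _ h0.le, mul_comm L, ENNReal.div_mul_cancel hL0 hLt]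
  calc ∫⁻ x, f x ^ γ ∂m = L ^ γ * ∫⁻ x, (f x / L) ^ γ ∂m := by
        simp_rw [hf']
        rw [lintegral_const_mul' _ _ (ENNReal.rpow_ne_top_of_nonneg h0.le hLt)]
    _ ≤ L ^ γ * (2 ^ γ * ∑' i : ℤ, ((2 : ℝ≥0∞) ^ i) ^ γ *
          (m Set.univ * min 1 ((2 : ℝ≥0∞) ^ i)⁻¹)) := by
        gcongr
        refine (lintegral_rpow_le_tsum_two_zpow m (hf.div_const L) h0).trans ?_
        gcongr with i
        exact hb i
    _ = 2 ^ γ * S * (L ^ γ * m Set.univ) := by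
        simp_rw [mul_left_comm _ (m Set.univ)]
        rw [ENNReal.tsum_mul_left]
        ring
    _ = _ := by
        congr 1
        rw [hL, ENNReal.div_rpow_of_nonneg _ _ h0.le, ENNReal.rpow_sub _ _ hm0 hmt,
          ENNReal.rpow_one, div_eq_mul_inv, div_eq_mul_inv]
        ring

/-- Only levels `t < 1` contribute, and there `t^r m{f > t} ≤ t^(r-1)`, summable over `t = 2^(-n-1)`
as `r > 1`. -/
theorem exists_lintegral_rpow_le_of_weak_of_le_one {r : ℝ} (h1 : 1 < r) :
    ∃ C : ℝ≥0∞, C ≠ ∞ ∧ ∀ (X : Type) [MeasurableSpace X] (m : Measure X) (f : X → ℝ≥0∞)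
      (_ : Measurable f), (∀ x, f x ≤ 1) → (∀ t, t ≠ 0 → t ≠ ∞ → t * m {x | t < f x} ≤ 1) →
        ∫⁻ x, f x ^ r ∂m ≤ C := by
  have h0 : 0 < r := by linarith
  refine ⟨2 ^ r * ∑' n : ℕ, ((2 : ℝ≥0∞) ^ (-((n : ℤ) + 1))) ^ (r - 1),
    ENNReal.mul_ne_top (ENNReal.rpow_ne_top_of_nonneg h0.le (by simp))
      (tsum_int_two_zpow_rpow_ne_top (by linarith)), ?_⟩
  intro X _ m f hf hf1 hA
  refine (lintegral_rpow_le_tsum_two_zpow m hf h0).trans ?_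
  gcongr
  rw [tsum_of_nat_of_neg_add_one ENNReal.summable ENNReal.summable]
  have hz : ∀ n : ℕ, ((2 : ℝ≥0∞) ^ (n : ℤ)) ^ r * m {x | (2 : ℝ≥0∞) ^ (n : ℤ) < f x} = 0 :=
    fun n => by
      have : {x | (2 : ℝ≥0∞) ^ (n : ℤ) < f x} = ∅ := by
        ext x
        simp only [Set.mem_ofPred_eq, Set.mem_empty_iff_false, iff_false, not_lt, zpow_natCast]
        exact (hf1 x).trans (one_le_pow₀ (by norm_num))
      rw [this]; simp
  simp only [hz, tsum_zero, zero_add]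
  refine ENNReal.tsum_le_tsum fun n => ?_
  set y : ℝ≥0∞ := (2 : ℝ≥0∞) ^ (-((n : ℤ) + 1)) with hy
  have h2 : y ≠ 0 := (ENNReal.zpow_pos (by simp) (by simp) _).ne'
  have h2' : y ≠ ∞ := (ENNReal.zpow_lt_top (by simp) (by simp) _).ne
  calc y ^ r * m {x | y < f x} = y ^ (r - 1) * (y * m {x | y < f x}) := by
        rw [← mul_assoc]
        congr 1
        nth_rewrite 3 [← ENNReal.rpow_one y]
        rw [← ENNReal.rpow_add _ _ h2 h2']; simp
    _ ≤ y ^ (r - 1) * 1 := by gcongr; exact hA y h2 h2'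
    _ = _ := mul_one _

/-! ### Tails of two-sided sequences: discrete versions of `∫ T^(-γ) dT`. -/

/-- The tail sum `∑_{j ≥ k} a j` of a two-sided sequence. -/
noncomputable def intTail (a : ℤ → ℝ≥0∞) (k : ℤ) : ℝ≥0∞ := ∑' j : ℤ, if k ≤ j then a j else 0

theorem intTail_le_tsum (a : ℤ → ℝ≥0∞) (k : ℤ) : intTail a k ≤ ∑' j, a j :=
  ENNReal.tsum_le_tsum fun j => by split_ifs <;> simp

theorem intTail_antitone (a : ℤ → ℝ≥0∞) : Antitone (intTail a) := fun k l h =>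
  ENNReal.tsum_le_tsum fun j => by
    split_ifs with h1 h2
    · exact le_rfl
    · exact absurd (h.trans h1) h2
    · simp
    · simp

theorem le_intTail (a : ℤ → ℝ≥0∞) (k : ℤ) : a k ≤ intTail a k := by
  refine le_trans ?_ (ENNReal.le_tsum k)
  simp

theorem sum_le_intTail (a : ℤ → ℝ≥0∞) {k : ℤ} {F : Finset ℤ} (hF : ∀ j ∈ F, k ≤ j) :
    ∑ j ∈ F, a j ≤ intTail a k := by
  refine le_trans (le_of_eq ?_) (ENNReal.sum_le_tsum F)
  exact Finset.sum_congr rfl fun j hj => by rw [if_pos (hF j hj)]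

theorem iSup_intTail (a : ℤ → ℝ≥0∞) : ⨆ k, intTail a k = ∑' j, a j := by
  refine le_antisymm (iSup_le (intTail_le_tsum a)) ?_
  rw [ENNReal.tsum_eq_iSup_sum]
  refine iSup_le fun F => ?_
  obtain ⟨k, hk⟩ := F.bddBelow
  exact (sum_le_intTail a fun j hj => hk hj).trans (le_iSup (intTail a) k)

/-- The measure on `ℤ` with point masses `a k`. -/
noncomputable def weightMeasure (a : ℤ → ℝ≥0∞) : Measure ℤ := Measure.count.withDensity a

theorem lintegral_weightMeasure (a f : ℤ → ℝ≥0∞) :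
    ∫⁻ k, f k ∂(weightMeasure a) = ∑' k, a k * f k := by
  rw [weightMeasure, lintegral_withDensity_eq_lintegral_mul _ (measurable_of_countable _)
    (measurable_of_countable _), lintegral_count]
  rfl

theorem weightMeasure_apply (a : ℤ → ℝ≥0∞) (S : Set ℤ) :
    weightMeasure a S = ∑' k, S.indicator a k := by
  rw [weightMeasure, withDensity_apply _ (MeasurableSet.of_discrete),
    ← lintegral_indicator (MeasurableSet.of_discrete), lintegral_count]

/-- Discrete form of "`dT` gives `{T < t}` mass at most `t`": a finite sum over such indices is at
most the tail at the smallest of them. -/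
theorem weightMeasure_intTail_lt_le (a : ℤ → ℝ≥0∞) (s : ℝ≥0∞) :
    weightMeasure a {k | intTail a k < s} ≤ s := by
  classical
  rw [weightMeasure_apply, ENNReal.tsum_eq_iSup_sum]
  refine iSup_le fun F => ?_
  set F' := F.filter (fun k => intTail a k < s) with hF'
  have hsum : ∑ k ∈ F, {k | intTail a k < s}.indicator a k = ∑ k ∈ F', a k := by
    rw [hF', Finset.sum_filter]
    exact Finset.sum_congr rfl fun k _ => by simp [Set.indicator]
  rw [hsum]
  rcases F'.eq_empty_or_nonempty with h | h
  · rw [h]; simp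
  · refine (sum_le_intTail a (k := F'.min' h) fun j hj => F'.min'_le j hj).trans ?_
    have := F'.min'_mem h
    exact (Finset.mem_filter.1 this).2.le

/-- If `a k ≥ β k * (tail of a)^γ`, then `∑ β` is controlled by `(∑ a)^(1-γ)`. -/
theorem exists_tsum_le_of_mul_intTail_rpow_le {γ : ℝ} (h0 : 0 < γ) (h1 : γ < 1) :
    ∃ C : ℝ≥0∞, C ≠ ∞ ∧ ∀ a β : ℤ → ℝ≥0∞, (∀ k, intTail a k ≠ 0) → ∑' k, a k ≠ ∞ →
      (∀ k, β k * intTail a k ^ γ ≤ a k) → ∑' k, β k ≤ C * (∑' k, a k) ^ (1 - γ) := by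
  obtain ⟨C, hC, H⟩ := exists_lintegral_rpow_le_of_weak h0 h1
  refine ⟨C, hC, fun a β ha hat hβ => ?_⟩
  have hT : ∀ k, intTail a k ≠ ∞ := fun k => ne_top_of_le_ne_top hat (intTail_le_tsum a k)
  -- For the measure with masses `a k`, the function `1/T` is of weak type with constant 1, so
  -- Kolmogorov's inequality bounds `∑ a_k T_k^(-γ)`.
  have key := H ℤ (weightMeasure a) (fun k => (intTail a k)⁻¹) (measurable_of_countable _) 1 (by
    intro t ht ht'
    have : {x | t < (intTail a x)⁻¹} = {x | intTail a x < t⁻¹} := by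
      ext x; simp only [Set.mem_ofPred_eq]; rw [ENNReal.lt_inv_iff_lt_inv]
    rw [this]
    calc t * _ ≤ t * t⁻¹ := by gcongr; exact weightMeasure_intTail_lt_le a _
      _ ≤ 1 := ENNReal.mul_inv_le_one t)
  rw [lintegral_weightMeasure, weightMeasure_apply] at key
  simp only [Set.indicator_univ, ENNReal.one_rpow, one_mul] at key
  refine le_trans (ENNReal.tsum_le_tsum fun k => ?_) key
  rw [ENNReal.inv_rpow, ← div_eq_mul_inv, ENNReal.le_div_iff_mul_le]
  · exact hβ k
  · left; simp [ENNReal.rpow_eq_zero_iff, ha k, hT k]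
  · left; exact ENNReal.rpow_ne_top_of_nonneg h0.le (hT k)

/-- Discrete form of `∫₀^∞ (1+T)^(-r) dT < ∞`; the bound does not depend on `∑ a`, which may be
infinite. -/
theorem exists_tsum_mul_one_add_intTail_rpow_le {r : ℝ} (h1 : 1 < r) :
    ∃ C : ℝ≥0∞, C ≠ ∞ ∧ ∀ a : ℤ → ℝ≥0∞, ∑' k, a k * ((1 + intTail a k)⁻¹) ^ r ≤ C := by
  obtain ⟨C, hC, H⟩ := exists_lintegral_rpow_le_of_weak_of_le_one h1
  refine ⟨C, hC, fun a => ?_⟩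
  rw [← lintegral_weightMeasure a]
  refine H ℤ (weightMeasure a) _ (measurable_of_countable _) (fun k => by simp) ?_
  intro t ht ht'
  have : {x | t < (1 + intTail a x)⁻¹} ⊆ {x | intTail a x < t⁻¹} := by
    intro x hx
    simp only [Set.mem_ofPred_eq] at hx ⊢
    rw [ENNReal.lt_inv_iff_lt_inv] at hx
    exact lt_of_le_of_lt le_add_self hx
  calc t * _ ≤ t * t⁻¹ := by
        gcongr; exact (measure_mono this).trans (weightMeasure_intTail_lt_le a _)
    _ ≤ 1 := ENNReal.mul_inv_le_one t

/-! ### Dyadic sums for radial integrals and Wolff potentials. -/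

/-- The dyadic term `(φ(2^k) / 2^(dk))^s`. -/
noncomputable def scaleTerm (d s : ℝ) (φ : ℝ → ℝ≥0∞) (k : ℤ) : ℝ≥0∞ :=
  (φ ((2 : ℝ) ^ k) * (2 : ℝ≥0∞) ^ (-(d * k))) ^ s

/-- The radial integral `∫₀^∞ (φ(t) / t^d)^s dt/t`. -/
noncomputable def radialIntegral (d s : ℝ) (φ : ℝ → ℝ≥0∞) : ℝ≥0∞ :=
  ∫⁻ t in Set.Ioi (0 : ℝ), (φ t / ENNReal.ofReal (t ^ d)) ^ s / ENNReal.ofReal t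

theorem ENNReal.two_rpow_ne_zero (r : ℝ) : (2 : ℝ≥0∞) ^ r ≠ 0 :=
  (ENNReal.rpow_pos (by simp) (by simp)).ne'

theorem ENNReal.two_rpow_ne_top (r : ℝ) : (2 : ℝ≥0∞) ^ r ≠ ∞ := by
  simp [ENNReal.rpow_eq_top_iff]

theorem ENNReal.two_rpow_add (r t : ℝ) : (2 : ℝ≥0∞) ^ (r + t) = 2 ^ r * 2 ^ t :=
  ENNReal.rpow_add _ _ (by simp) (by simp)

theorem ENNReal.ofReal_two_zpow (k : ℤ) : ENNReal.ofReal ((2 : ℝ) ^ k) = (2 : ℝ≥0∞) ^ (k : ℝ) := by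
  rw [← Real.rpow_intCast, ← ENNReal.ofReal_rpow_of_pos two_pos]; simp

theorem ENNReal.ofReal_two_zpow_rpow (d : ℝ) (k : ℤ) :
    ENNReal.ofReal (((2 : ℝ) ^ k) ^ d) = (2 : ℝ≥0∞) ^ (d * k) := by
  rw [← ENNReal.ofReal_rpow_of_pos (by positivity), ENNReal.ofReal_two_zpow, ← ENNReal.rpow_mul,
    mul_comm]

theorem lintegral_Ioi_eq_tsum_two_zpow (f : ℝ → ℝ≥0∞) :
    ∫⁻ t in Set.Ioi (0 : ℝ), f t = ∑' k : ℤ, ∫⁻ t in Set.Ico ((2 : ℝ) ^ k) (2 ^ (k + 1)), f t := by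
  have hU : Set.Ioi (0 : ℝ) = ⋃ k : ℤ, Set.Ico ((2 : ℝ) ^ k) (2 ^ (k + 1)) := by
    ext t
    simp only [Set.mem_Ioi, Set.mem_iUnion]
    constructor
    · intro ht
      exact exists_mem_Ico_zpow ht one_lt_two
    · rintro ⟨k, hk⟩
      exact lt_of_lt_of_le (by positivity) hk.1
  rw [hU, lintegral_iUnion (fun _ => measurableSet_Ico)]
  have hm : Monotone (fun k : ℤ => (2 : ℝ) ^ k) := fun a b h =>
    zpow_le_zpow_right₀ one_le_two h
  exact hm.pairwise_disjoint_on_Ico_succ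

section DyadicWolff

variable {d s : ℝ}

theorem scaleTerm_succ (hs : 0 ≤ s) (φ : ℝ → ℝ≥0∞) (k : ℤ) :
    (φ ((2 : ℝ) ^ (k + 1)) * (2 : ℝ≥0∞) ^ (-(d * k))) ^ s =
      2 ^ (d * s) * scaleTerm d s φ (k + 1) := by
  have : -(d * (k : ℝ)) = d + -(d * ((k + 1 : ℤ) : ℝ)) := by push_cast; ring
  rw [scaleTerm, this, ENNReal.two_rpow_add, mul_left_comm, ENNReal.mul_rpow_of_nonneg _ _ hs,
    ← ENNReal.rpow_mul]

theorem radialIntegral_le_tsum (hd : 0 ≤ d) (hs : 0 ≤ s) {φ : ℝ → ℝ≥0∞} (hφ : Monotone φ) :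
    radialIntegral d s φ ≤ 2 ^ (d * s) * ∑' k, scaleTerm d s φ k := by
  rw [radialIntegral, lintegral_Ioi_eq_tsum_two_zpow, ← ENNReal.tsum_mul_left,
    ← (Equiv.addRight (1 : ℤ)).tsum_eq fun k => 2 ^ (d * s) * scaleTerm d s φ k]
  refine ENNReal.tsum_le_tsum fun k => ?_
  have hvol : volume (Set.Ico ((2 : ℝ) ^ k) (2 ^ (k + 1))) = (2 : ℝ≥0∞) ^ (k : ℝ) := by
    rw [Real.volume_Ico, ← ENNReal.ofReal_two_zpow, zpow_add₀ (by norm_num)]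
    congr 1; ring
  calc _ ≤ ∫⁻ t in Set.Ico ((2 : ℝ) ^ k) (2 ^ (k + 1)),
        (φ ((2 : ℝ) ^ (k + 1)) * (2 : ℝ≥0∞) ^ (-(d * k))) ^ s / (2 : ℝ≥0∞) ^ (k : ℝ) := by
        refine setLIntegral_mono' measurableSet_Ico fun t ht => ?_
        have ht0 : (0 : ℝ) < 2 ^ k := by positivity
        rw [← ENNReal.ofReal_two_zpow, ENNReal.rpow_neg, ← ENNReal.ofReal_two_zpow_rpow,
          ← div_eq_mul_inv]
        gcongr
        · exact hφ ht.2.le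
        · exact ht.1
        · exact ht.1
    _ = _ := by
        rw [setLIntegral_const, hvol, ENNReal.div_mul_cancel (ENNReal.two_rpow_ne_zero _)
          (ENNReal.two_rpow_ne_top _), scaleTerm_succ hs]
        rfl

/-- Only monotonicity of `φ` enters, so the bound serves both for `ν(B(x,t))` and for powers of
`κ(B(x,t))`. -/
theorem tsum_le_radialIntegral (hd : 0 ≤ d) (hs : 0 ≤ s) {φ : ℝ → ℝ≥0∞} (hφ : Monotone φ) :
    ∑' k, scaleTerm d s φ k ≤ 2 ^ (d * s + 1) * radialIntegral d s φ := by
  rw [radialIntegral, lintegral_Ioi_eq_tsum_two_zpow, ← ENNReal.tsum_mul_left]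
  refine ENNReal.tsum_le_tsum fun k => ?_
  have hvol : volume (Set.Ico ((2 : ℝ) ^ k) (2 ^ (k + 1))) = (2 : ℝ≥0∞) ^ (k : ℝ) := by
    rw [Real.volume_Ico, ← ENNReal.ofReal_two_zpow, zpow_add₀ (by norm_num)]
    congr 1; ring
  have hlow : ∫⁻ t in Set.Ico ((2 : ℝ) ^ k) (2 ^ (k + 1)),
        (φ ((2 : ℝ) ^ k) * (2 : ℝ≥0∞) ^ (-(d * (k + 1 : ℤ)))) ^ s /
          (2 : ℝ≥0∞) ^ ((k + 1 : ℤ) : ℝ) ≤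
      ∫⁻ t in Set.Ico ((2 : ℝ) ^ k) (2 ^ (k + 1)),
        (φ t / ENNReal.ofReal (t ^ d)) ^ s / ENNReal.ofReal t := by
    refine setLIntegral_mono' measurableSet_Ico fun t ht => ?_
    have ht0 : (0 : ℝ) < t := lt_of_lt_of_le (by positivity) ht.1
    rw [← ENNReal.ofReal_two_zpow, ENNReal.rpow_neg, ← ENNReal.ofReal_two_zpow_rpow,
      ← div_eq_mul_inv]
    gcongr
    · exact hφ ht.1
    · exact ht.2.le
    · exact ht.2.le
  refine le_trans (le_of_eq ?_) (mul_le_mul_right hlow _)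
  rw [setLIntegral_const, hvol, scaleTerm]
  have e1 : -(d * ((k + 1 : ℤ) : ℝ)) = -d + -(d * (k : ℝ)) := by push_cast; ring
  rw [e1, ENNReal.two_rpow_add (-d), mul_left_comm (φ _),
    ENNReal.mul_rpow_of_nonneg ((2 : ℝ≥0∞) ^ (-d)) _ hs,
    ← ENNReal.rpow_mul, div_eq_mul_inv, ← ENNReal.rpow_neg]
  set z := (φ ((2 : ℝ) ^ k) * 2 ^ (-(d * (k : ℝ)))) ^ s
  calc z = z * 2 ^ (0 : ℝ) := by simp
    _ = z * 2 ^ ((d * s + 1) + (-d * s) + (-((k + 1 : ℤ) : ℝ)) + (k : ℝ)) := by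
      congr 2; push_cast; ring
    _ = _ := by
      rw [ENNReal.two_rpow_add, ENNReal.two_rpow_add, ENNReal.two_rpow_add]; ring

theorem ball_two_zpow_subset {X : Type*} [PseudoMetricSpace X] {x y : X} {j k : ℤ} (h : dist y x < 2 ^ k) (hkj : k ≤ j) :
    Metric.ball x (2 ^ j) ⊆ Metric.ball y (2 ^ (j + 1)) := by
  refine Metric.ball_subset_ball' ?_
  have h1 : (2 : ℝ) ^ k ≤ 2 ^ j := zpow_le_zpow_right₀ one_le_two hkj
  rw [zpow_add_one₀ (by norm_num), dist_comm]
  linarith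

theorem iUnion_ball_two_zpow {X : Type*} [PseudoMetricSpace X] (x : X) : ⋃ k : ℤ, Metric.ball x ((2 : ℝ) ^ k) = Set.univ := by
  refine Set.eq_univ_of_forall fun y => ?_
  obtain ⟨k, hk⟩ := pow_unbounded_of_one_lt (dist y x) one_lt_two
  exact Set.mem_iUnion.2 ⟨k, by simpa using hk⟩

variable {X : Type*} [PseudoMetricSpace X] [MeasurableSpace X]

/-- The dyadic terms of the Wolff potential of a measure. -/
noncomputable def ballTerm (d s : ℝ) (ν : Measure X) (x : X) (k : ℤ) : ℝ≥0∞ :=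
  scaleTerm d s (fun t => ν (Metric.ball x t)) k

/-- The dyadic Wolff potential of a measure. -/
noncomputable def dyadicWolff (d s : ℝ) (ν : Measure X) (x : X) : ℝ≥0∞ := ∑' k, ballTerm d s ν x k

/-- An open ball is the increasing union of smaller concentric balls, whence lower semicontinuity in
the centre. -/
theorem measurable_measure_ball [OpensMeasurableSpace X] (ν : Measure X) (r : ℝ) :
    Measurable fun x => ν (Metric.ball x r) := by
  refine LowerSemicontinuous.measurable fun x c hc => ?_
  have hU : Metric.ball x r = ⋃ m : ℕ, Metric.ball x (r - 1 / ((m : ℝ) + 1)) := by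
    ext y
    simp only [Metric.mem_ball, Set.mem_iUnion]
    constructor
    · intro h
      obtain ⟨m, hm⟩ := exists_nat_one_div_lt (sub_pos.2 h)
      exact ⟨m, by linarith⟩
    · rintro ⟨m, hm⟩
      have : 0 < 1 / ((m : ℝ) + 1) := by positivity
      linarith
  have hmono : Monotone fun m : ℕ => Metric.ball x (r - 1 / ((m : ℝ) + 1)) := fun a b h => by
    refine Metric.ball_subset_ball ?_
    have : (1 : ℝ) / ((b : ℝ) + 1) ≤ 1 / ((a : ℝ) + 1) := by
      apply one_div_le_one_div_of_le (by positivity); exact_mod_cast Nat.succ_le_succ h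
    linarith
  change c < ν (Metric.ball x r) at hc
  rw [hU, hmono.measure_iUnion] at hc
  obtain ⟨m, hm⟩ := lt_iSup_iff.1 hc
  have hpos : 0 < 1 / ((m : ℝ) + 1) := by positivity
  filter_upwards [Metric.ball_mem_nhds x hpos] with y hy
  refine lt_of_lt_of_le hm (measure_mono (Metric.ball_subset_ball' ?_))
  rw [Metric.mem_ball, dist_comm] at hy
  linarith

theorem measurable_ballTerm [OpensMeasurableSpace X] (ν : Measure X) (k : ℤ) :
    Measurable fun x => ballTerm d s ν x k :=
  ((measurable_measure_ball ν _).mul_const _).pow_const _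

theorem ballTerm_le_of_subset (hs : 0 ≤ s) {ν : Measure X} {x y : X} {k : ℤ}
    (h : Metric.ball x (2 ^ k) ⊆ Metric.ball y (2 ^ (k + 1))) :
    ballTerm d s ν x k ≤ 2 ^ (d * s) * ballTerm d s ν y (k + 1) := by
  rw [ballTerm, ballTerm, ← scaleTerm_succ hs]
  exact ENNReal.rpow_le_rpow (mul_le_mul_left (measure_mono h) _) hs

theorem ballTerm_le_ballTerm_succ (hs : 0 ≤ s) {ν : Measure X} {x y : X} {j k : ℤ}
    (h : dist y x < 2 ^ k) (hkj : k ≤ j) :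
    ballTerm d s ν x j ≤ 2 ^ (d * s) * ballTerm d s ν y (j + 1) :=
  ballTerm_le_of_subset hs (ball_two_zpow_subset h hkj)

/-- For `j ≥ k` one has `B(x,2^j) ⊆ B(y,2^(j+1))`. This stability of tails under small moves of the
centre underlies both bounds. -/
theorem intTail_ballTerm_le (hs : 0 ≤ s) {ν : Measure X} {x y : X} {k : ℤ}
    (h : dist y x < 2 ^ k) :
    intTail (ballTerm d s ν x) k ≤ 2 ^ (d * s) * intTail (ballTerm d s ν y) (k + 1) := by
  rw [intTail, intTail, ← ENNReal.tsum_mul_left,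
    ← (Equiv.addRight (1 : ℤ)).tsum_eq fun j => 2 ^ (d * s) *
      (if k + 1 ≤ j then ballTerm d s ν y j else 0)]
  refine ENNReal.tsum_le_tsum fun j => ?_
  simp only [Equiv.coe_addRight, add_le_add_iff_right]
  split_ifs with hkj
  · exact ballTerm_le_ballTerm_succ hs h hkj
  · simp

theorem intTail_ballTerm_le_dyadicWolff (hs : 0 ≤ s) {ν : Measure X} {x y : X} {k : ℤ}
    (h : dist y x < 2 ^ k) :
    intTail (ballTerm d s ν x) k ≤ 2 ^ (d * s) * dyadicWolff d s ν y :=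
  (intTail_ballTerm_le hs h).trans (by gcongr; exact intTail_le_tsum _ _)

/-- Localisation: balls about `y` of radius below `2^k` stay inside `B(x,2^(k+1))`, and the larger
ones are contained in balls about `x` one scale up. -/
theorem dyadicWolff_le_restrict_add [OpensMeasurableSpace X] (hs : 0 ≤ s) {ν : Measure X}
    {x y : X} {k : ℤ} (h : dist y x < 2 ^ k) :
    dyadicWolff d s ν y ≤ dyadicWolff d s (ν.restrict (Metric.ball x (2 ^ (k + 1)))) y +
      2 ^ (d * s) * intTail (ballTerm d s ν x) k := by
  have h' : dist x y < 2 ^ k := by rwa [dist_comm]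
  have hle : ∀ j, ballTerm d s ν y j ≤
      ballTerm d s (ν.restrict (Metric.ball x (2 ^ (k + 1)))) y j +
        2 ^ (d * s) * (if k ≤ j + 1 then ballTerm d s ν x (j + 1) else 0) := fun j => by
    rcases le_or_gt k j with hkj | hkj
    · rw [if_pos (by omega)]
      exact (ballTerm_le_ballTerm_succ hs h' hkj).trans le_add_self
    · refine le_trans (le_of_eq ?_) le_self_add
      have hsub : Metric.ball y ((2 : ℝ) ^ j) ⊆ Metric.ball x (2 ^ (k + 1)) :=
        (Metric.ball_subset_ball (zpow_le_zpow_right₀ one_le_two hkj.le)).trans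
          (ball_two_zpow_subset h' le_rfl)
      rw [ballTerm, ballTerm, scaleTerm, scaleTerm, Measure.restrict_apply Metric.isOpen_ball.measurableSet,
        Set.inter_eq_left.2 hsub]
  calc dyadicWolff d s ν y ≤ _ := ENNReal.tsum_le_tsum hle
    _ = _ := by
      rw [ENNReal.tsum_add, ENNReal.tsum_mul_left, intTail,
        ← (Equiv.addRight (1 : ℤ)).tsum_eq fun j => if k ≤ j then ballTerm d s ν x j else 0]
      rfl

theorem ballTerm_mono (hs : 0 ≤ s) {ν ν' : Measure X} (h : ν ≤ ν') (x : X) (k : ℤ) :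
    ballTerm d s ν x k ≤ ballTerm d s ν' x k :=
  ENNReal.rpow_le_rpow (mul_le_mul_left (h _) _) hs

theorem dyadicWolff_mono (hs : 0 ≤ s) {ν ν' : Measure X} (h : ν ≤ ν') (x : X) :
    dyadicWolff d s ν x ≤ dyadicWolff d s ν' x :=
  ENNReal.tsum_le_tsum fun k => ballTerm_mono hs h x k

theorem ballTerm_add_le (hs : 0 ≤ s) (ν ν' : Measure X) (x : X) (k : ℤ) :
    ballTerm d s (ν + ν') x k ≤ 2 ^ s * (ballTerm d s ν x k + ballTerm d s ν' x k) := by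
  simp only [ballTerm, scaleTerm, Measure.add_apply, add_mul]
  exact ENNReal.add_rpow_le_two_rpow_mul _ _ hs

theorem dyadicWolff_add_le (hs : 0 ≤ s) (ν ν' : Measure X) (x : X) :
    dyadicWolff d s (ν + ν') x ≤ 2 ^ s * (dyadicWolff d s ν x + dyadicWolff d s ν' x) := by
  rw [dyadicWolff, dyadicWolff, dyadicWolff, ← ENNReal.tsum_add, ← ENNReal.tsum_mul_left]
  exact ENNReal.tsum_le_tsum fun k => ballTerm_add_le hs ν ν' x k

theorem measure_ball_ne_top_of_dyadicWolff_ne_top (hs : 0 < s) {ν : Measure X} {x : X}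
    (h : dyadicWolff d s ν x ≠ ∞) (k : ℤ) : ν (Metric.ball x (2 ^ k)) ≠ ∞ := by
  intro hk
  refine h (top_unique (le_trans (le_of_eq ?_) (ENNReal.le_tsum k)))
  rw [ballTerm, scaleTerm, hk, ENNReal.top_mul (ENNReal.two_rpow_ne_zero _),
    ENNReal.top_rpow_of_pos hs]

theorem exists_measure_ball_two_zpow_ne_zero {ν : Measure X} (hν : ν ≠ 0) (x : X) :
    ∃ k : ℤ, ν (Metric.ball x (2 ^ k)) ≠ 0 := by
  by_contra! h
  have := measure_iUnion_null h
  rw [iUnion_ball_two_zpow] at this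
  exact hν (Measure.measure_univ_eq_zero.1 this)

theorem intTail_ballTerm_ne_zero (hs : 0 < s) {ν : Measure X} (hν : ν ≠ 0) (x : X) (k : ℤ) :
    intTail (ballTerm d s ν x) k ≠ 0 := by
  obtain ⟨j, hj⟩ := exists_measure_ball_two_zpow_ne_zero hν x
  have hj' : ν (Metric.ball x (2 ^ (max j k))) ≠ 0 := fun h0 => hj (measure_mono_null
    (Metric.ball_subset_ball (zpow_le_zpow_right₀ one_le_two (le_max_left _ _))) h0)
  have h1 : ballTerm d s ν x (max j k) ≠ 0 := by
    rw [ballTerm, scaleTerm]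
    simp [ENNReal.rpow_eq_zero_iff, hs.not_gt, hj']
  intro h0
  exact h1 (le_antisymm (((le_intTail _ _).trans (intTail_antitone _ (le_max_right j k))).trans
    h0.le) (zero_le))

theorem dyadicWolff_ne_zero (hs : 0 < s) {ν : Measure X} (hν : ν ≠ 0) (x : X) :
    dyadicWolff d s ν x ≠ 0 := fun h0 =>
  intTail_ballTerm_ne_zero (d := d) hs hν x 0
    (le_antisymm ((intTail_le_tsum _ _).trans h0.le) (zero_le))

end DyadicWolff

/-! ### The centred maximal function with respect to an arbitrary measure. -/

/-- The centred maximal function of `ν` with respect to `ω`, over balls of dyadic radii. -/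
noncomputable def dyadicMaximal {X : Type*} [PseudoMetricSpace X] [MeasurableSpace X]
    (ν ω : Measure X) (x : X) : ℝ≥0∞ :=
  ⨆ k : ℤ, ν (Metric.ball x (2 ^ k)) / ω (Metric.ball x (2 ^ k))

theorem measurable_dyadicMaximal {X : Type*} [PseudoMetricSpace X] [MeasurableSpace X]
    [OpensMeasurableSpace X] (ν ω : Measure X) : Measurable (dyadicMaximal ν ω) :=
  Measurable.iSup fun _ => (measurable_measure_ball ν _).div (measurable_measure_ball ω _)

/-- Weak (1,1) bound without doubling: Besicovitch covers by `N` disjoint families of balls with `t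
ω(B) ≤ ν(B)`. -/
theorem exists_mul_measure_lt_dyadicMaximal_le (X : Type*) [MetricSpace X]
    [TopologicalSpace.SeparableSpace X] [MeasurableSpace X] [OpensMeasurableSpace X]
    [HasBesicovitchCovering X] :
    ∃ N : ℝ≥0∞, N ≠ ∞ ∧ ∀ (ν ω : Measure X) (t : ℝ≥0∞),
      t * ω {x | t < dyadicMaximal ν ω x} ≤ N * ν Set.univ := by
  obtain ⟨N, τ, hτ, hN⟩ := HasBesicovitchCovering.no_satelliteConfig (α := X)
  refine ⟨N, ENNReal.natCast_ne_top N, fun ν ω t => ?_⟩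
  -- Besicovitch coverings need bounded radii; the truncated sets increase to the whole level set.
  let S : ℕ → Set X := fun K =>
    {x | ∃ k : ℤ, k ≤ K ∧ t < ν (Metric.ball x (2 ^ k)) / ω (Metric.ball x (2 ^ k))}
  have hS : {x | t < dyadicMaximal ν ω x} = ⋃ K, S K := by
    ext x
    simp only [Set.mem_ofPred_eq, dyadicMaximal, lt_iSup_iff, Set.mem_iUnion, S]
    constructor
    · rintro ⟨k, hk⟩
      exact ⟨k.toNat, k, Int.self_le_toNat k, hk⟩
    · rintro ⟨K, k, -, hk⟩
      exact ⟨k, hk⟩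
  have hmono : Monotone S := fun K L h x ⟨k, hk, hx⟩ =>
    ⟨k, hk.trans (by exact_mod_cast h), hx⟩
  rw [hS, hmono.measure_iUnion, ENNReal.mul_iSup]
  refine iSup_le fun K => ?_
  have hch : ∀ x : S K, ∃ k : ℤ, k ≤ K ∧
    t < ν (Metric.ball (x : X) (2 ^ k)) / ω (Metric.ball (x : X) (2 ^ k)) := fun x => x.2
  choose k hkK hk using hch
  let B : Besicovitch.BallPackage (S K) X :=
    { c := fun x => x
      r := fun x => 2 ^ k x
      rpos := fun x => by positivity
      r_bound := 2 ^ (K : ℤ)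
      r_le := fun x => zpow_le_zpow_right₀ one_le_two (hkK x) }
  obtain ⟨F, hdisj, hcov⟩ := Besicovitch.exist_disjoint_covering_families hτ hN B
  have hcount : ∀ i, (F i).Countable := fun i =>
    (hdisj i).countable_of_nonempty_interior fun j _ =>
      ⟨B.c j, Metric.ball_subset_interior_closedBall (Metric.mem_ball_self (B.rpos j))⟩
  have hsub : S K ⊆ ⋃ i : Fin N, ⋃ j ∈ F i, Metric.ball (B.c j) (B.r j) := fun x hx =>
    hcov ⟨⟨x, hx⟩, rfl⟩
  have hi : ∀ i, t * ω (⋃ j ∈ F i, Metric.ball (B.c j) (B.r j)) ≤ ν Set.univ := fun i => by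
    have := (hcount i).to_subtype
    calc t * ω (⋃ j ∈ F i, Metric.ball (B.c j) (B.r j))
        ≤ t * ∑' j : F i, ω (Metric.ball (B.c j) (B.r j)) := by
          gcongr; exact measure_biUnion_le ω (hcount i) _
      _ = ∑' j : F i, t * ω (Metric.ball (B.c j) (B.r j)) := ENNReal.tsum_mul_left.symm
      _ ≤ ∑' j : F i, ν (Metric.ball (B.c j) (B.r j)) :=
          ENNReal.tsum_le_tsum fun j => ENNReal.mul_le_of_le_div (hk j).le
      _ = ν (⋃ j ∈ F i, Metric.ball (B.c j) (B.r j)) := by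
          rw [measure_biUnion (hcount i)]
          · exact (hdisj i).mono fun j => Metric.ball_subset_closedBall
          · exact fun j _ => Metric.isOpen_ball.measurableSet
      _ ≤ ν Set.univ := measure_mono (Set.subset_univ _)
  calc t * ω (S K) ≤ t * ∑ i : Fin N, ω (⋃ j ∈ F i, Metric.ball (B.c j) (B.r j)) := by
        gcongr
        exact (measure_mono hsub).trans (measure_iUnion_fintype_le _ _)
    _ = ∑ i : Fin N, t * ω (⋃ j ∈ F i, Metric.ball (B.c j) (B.r j)) := Finset.mul_sum _ _ _
    _ ≤ ∑ _i : Fin N, ν Set.univ := Finset.sum_le_sum fun i _ => hi i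
    _ = N * ν Set.univ := by simp

/-- Termwise from `ν(B) ≤ M ω(B)` for balls centred at `x`. Finiteness of `ω(B)` matters because
division by `∞` gives 0; `ω ≠ 0` settles the case `M = ∞`. -/
theorem dyadicWolff_le_dyadicMaximal_mul {X : Type*} [PseudoMetricSpace X] [MeasurableSpace X]
    {d s : ℝ} (hs : 0 < s) (ν : Measure X) {ω : Measure X} {x : X} (hω : ω ≠ 0)
    (hfin : ∀ k : ℤ, ω (Metric.ball x (2 ^ k)) ≠ ∞) :
    dyadicWolff d s ν x ≤ dyadicMaximal ν ω x ^ s * dyadicWolff d s ω x := by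
  rcases eq_or_ne (dyadicMaximal ν ω x) ∞ with hM | hM
  · rw [hM, ENNReal.top_rpow_of_pos hs, ENNReal.top_mul (dyadicWolff_ne_zero hs hω x)]
    exact le_top
  · rw [dyadicWolff, dyadicWolff, ← ENNReal.tsum_mul_left]
    refine ENNReal.tsum_le_tsum fun k => ?_
    rw [ballTerm, ballTerm, scaleTerm, scaleTerm, ← ENNReal.mul_rpow_of_nonneg _ _ hs.le,
      ← mul_assoc]
    refine ENNReal.rpow_le_rpow (mul_le_mul_left ?_ _) hs.le
    rw [← ENNReal.div_le_iff_le_mul (Or.inr hM) (Or.inl (hfin k))]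
    exact le_iSup (fun k : ℤ => ν (Metric.ball x (2 ^ k)) / ω (Metric.ball x (2 ^ k))) k

/-! ### The lower bound for supersolutions. -/

section Wolff

variable {n : ℕ} {p α q : ℝ}

theorem monotone_measure_ball (ν : Measure (EuclideanSpace ℝ (Fin n))) (x : EuclideanSpace ℝ (Fin n)) :
    Monotone fun t => ν (Metric.ball x t) := fun _ _ h => measure_mono (Metric.ball_subset_ball h)

theorem wolffPotential_le_dyadicWolff (hp : 1 < p) (hd : 0 < (n : ℝ) - α * p) (ν : Measure (EuclideanSpace ℝ (Fin n)))
    (x : EuclideanSpace ℝ (Fin n)) : wolffPotential α p ν x ≤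
      2 ^ (((n : ℝ) - α * p) * (1 / (p - 1))) *
        dyadicWolff ((n : ℝ) - α * p) (1 / (p - 1)) ν x := by
  have hs : 0 < 1 / (p - 1) := by have := sub_pos.2 hp; positivity
  exact radialIntegral_le_tsum hd.le hs.le (monotone_measure_ball ν x)

theorem dyadicWolff_le_wolffPotential (hp : 1 < p) (hd : 0 < (n : ℝ) - α * p) (ν : Measure (EuclideanSpace ℝ (Fin n)))
    (x : EuclideanSpace ℝ (Fin n)) : dyadicWolff ((n : ℝ) - α * p) (1 / (p - 1)) ν x ≤
      2 ^ (((n : ℝ) - α * p) * (1 / (p - 1)) + 1) * wolffPotential α p ν x := by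
  have hs : 0 < 1 / (p - 1) := by have := sub_pos.2 hp; positivity
  exact tsum_le_radialIntegral hd.le hs.le (monotone_measure_ball ν x)

theorem wolffPotential_zero (hp : 1 < p) (x : EuclideanSpace ℝ (Fin n)) : wolffPotential α p (0 : Measure (EuclideanSpace ℝ (Fin n))) x = 0 := by
  have hs : 0 < 1 / (p - 1) := by have := sub_pos.2 hp; positivity
  have hs' : 0 < p - 1 := sub_pos.2 hp
  simp [wolffPotential, hs']

/-- Bound of the embedding constant of a supersolution. -/
theorem exists_embeddingConst_rpow_le (n : ℕ) (hp : 1 < p) (hd : 0 < (n : ℝ) - α * p)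
    (hq : 0 < q) (hqp : q < p - 1) :
    ∃ C : ℝ≥0∞, C ≠ ∞ ∧ ∀ (σ : Measure (EuclideanSpace ℝ (Fin n))) (u : EuclideanSpace ℝ (Fin n) → ℝ≥0∞), AEMeasurable u σ →
      (∀ᵐ y ∂σ, wolffPotential α p (σ.withDensity fun z => u z ^ q) y ≤ u y) →
      (σ.withDensity fun z => u z ^ q) ≠ 0 →
      (∀ y, ∀ k : ℤ, (σ.withDensity fun z => u z ^ q) (Metric.ball y (2 ^ k)) ≠ ∞) →
      ∀ A : Set (EuclideanSpace ℝ (Fin n)), MeasurableSet A → embeddingConst α p q σ A ^ (q * (p - 1) / (p - 1 - q)) ≤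
        C * (σ.withDensity fun z => u z ^ q) A := by
  have hp' : 0 < p - 1 := sub_pos.2 hp
  have hs : 0 < 1 / (p - 1) := by positivity
  set d := (n : ℝ) - α * p with hd_def
  set s := 1 / (p - 1) with hs_def
  set γ := q * s with hγ_def
  have hγ0 : 0 < γ := by positivity
  have hγ1 : γ < 1 := by rw [hγ_def, hs_def, mul_one_div, div_lt_one hp']; exact hqp
  have hγ1' : 0 < 1 - γ := by linarith
  have hpq : 0 < p - 1 - q := by linarith
  obtain ⟨N, hN, hweak⟩ := exists_mul_measure_lt_dyadicMaximal_le (EuclideanSpace ℝ (Fin n))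
  obtain ⟨C, hC, hkol⟩ := exists_lintegral_rpow_le_of_weak hγ0 hγ1
  set c : ℝ≥0∞ := 2 ^ (d * s) * 2 ^ (d * s + 1) with hc
  have hct : c ≠ ∞ := ENNReal.mul_ne_top (ENNReal.two_rpow_ne_top _) (ENNReal.two_rpow_ne_top _)
  set C' : ℝ≥0∞ := (c ^ q * (C * N ^ γ)) ^ (1 / q) with hC'
  have hC't : C' ≠ ∞ := ENNReal.rpow_ne_top_of_nonneg (by positivity)
    (ENNReal.mul_ne_top (ENNReal.rpow_ne_top_of_nonneg hq.le hct)
      (ENNReal.mul_ne_top hC (ENNReal.rpow_ne_top_of_nonneg hγ0.le hN)))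
  have he : 0 < q * (p - 1) / (p - 1 - q) := by positivity
  refine ⟨C' ^ (q * (p - 1) / (p - 1 - q)), ENNReal.rpow_ne_top_of_nonneg he.le hC't, ?_⟩
  intro σ u hu hsup hω0 hωfin A hA
  set ω := σ.withDensity fun z => u z ^ q with hω
  have hκ : embeddingConst α p q σ A ≤ C' * ω A ^ ((1 - γ) / q) := by
    refine sInf_le fun ν _ => ?_
    have h1 : ∫⁻ y, wolffPotential α p ν y ^ q ∂(σ.restrict A) ≤
        c ^ q * (C * ((N * ν Set.univ) ^ γ * ω A ^ (1 - γ))) := by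
      calc ∫⁻ y, wolffPotential α p ν y ^ q ∂(σ.restrict A)
          ≤ ∫⁻ y, c ^ q * (u y ^ q * dyadicMaximal ν ω y ^ γ) ∂(σ.restrict A) := by
            refine lintegral_mono_ae ?_
            filter_upwards [ae_restrict_of_ae hsup] with y hy
            -- Here `Wω ≤ u` is used; after raising to the power `q`, the factor `u^q` turns `dσ`
            -- into `dω`.
            have h2 : wolffPotential α p ν y ≤ c * (u y * dyadicMaximal ν ω y ^ s) := by
              calc wolffPotential α p ν y ≤ 2 ^ (d * s) * dyadicWolff d s ν y :=
                    wolffPotential_le_dyadicWolff hp hd ν y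
                _ ≤ 2 ^ (d * s) * (dyadicMaximal ν ω y ^ s * (2 ^ (d * s + 1) * u y)) := by
                    gcongr
                    refine (dyadicWolff_le_dyadicMaximal_mul hs ν hω0 (hωfin y)).trans ?_
                    gcongr
                    refine (dyadicWolff_le_wolffPotential hp hd ω y).trans ?_
                    gcongr
                _ = _ := by rw [hc]; ring
            calc _ ≤ (c * (u y * dyadicMaximal ν ω y ^ s)) ^ q := ENNReal.rpow_le_rpow h2 hq.le
              _ = _ := by
                rw [ENNReal.mul_rpow_of_nonneg c _ hq.le, ENNReal.mul_rpow_of_nonneg (u y) _ hq.le,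
                  ← ENNReal.rpow_mul (dyadicMaximal ν ω y), mul_comm s q]
        _ = c ^ q * ∫⁻ y, dyadicMaximal ν ω y ^ γ ∂(ω.restrict A) := by
            rw [lintegral_const_mul' _ _ (ENNReal.rpow_ne_top_of_nonneg hq.le hct), hω,
              restrict_withDensity hA, lintegral_withDensity_eq_lintegral_mul₀
                (hu.restrict.pow_const q)
                ((measurable_dyadicMaximal ν ω).pow_const γ).aemeasurable]
            rfl
        _ ≤ _ := by
            gcongr
            have := hkol (EuclideanSpace ℝ (Fin n)) (ω.restrict A) (dyadicMaximal ν ω) (measurable_dyadicMaximal ν ω)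
              (N * ν Set.univ) (fun t _ _ => le_trans
                (mul_le_mul_right (Measure.restrict_apply_le _ _) _) (hweak ν ω t))
            rwa [Measure.restrict_apply_univ] at this
    calc _ ≤ (c ^ q * (C * ((N * ν Set.univ) ^ γ * ω A ^ (1 - γ)))) ^ (1 / q) :=
          ENNReal.rpow_le_rpow h1 (by positivity)
      _ = ((c ^ q * (C * N ^ γ)) * ω A ^ (1 - γ) * ν Set.univ ^ γ) ^ (1 / q) := by
          rw [ENNReal.mul_rpow_of_nonneg _ _ hγ0.le]; congr 1; ring
      _ = _ := by
          have hq1 : 0 ≤ 1 / q := by positivity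
          rw [ENNReal.mul_rpow_of_nonneg _ _ hq1, ENNReal.mul_rpow_of_nonneg _ _ hq1, ← hC',
            ← ENNReal.rpow_mul, ← ENNReal.rpow_mul, mul_one_div, mul_one_div]
          congr 2
          rw [hγ_def, hs_def]; field_simp
  calc _ ≤ (C' * ω A ^ ((1 - γ) / q)) ^ (q * (p - 1) / (p - 1 - q)) :=
        ENNReal.rpow_le_rpow hκ he.le
    _ = _ := by
      rw [ENNReal.mul_rpow_of_nonneg _ _ he.le, ← ENNReal.rpow_mul (ω A)]
      -- The exponent of `κ` equals `q/(1-γ)`, which leaves `ω(A)` to the first power.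
      have : (1 - γ) / q * (q * (p - 1) / (p - 1 - q)) = 1 := by
        rw [hγ_def, hs_def]; field_simp
      rw [this, ENNReal.rpow_one]

/-- On `B(x,2^k)` the function `u` dominates the tail at `x`, so `T_k^q σ(B) ≤ C ω(B)`; its `s`-th
power is the hypothesis of `exists_tsum_le_of_mul_intTail_rpow_le`. -/
theorem exists_dyadicWolff_le_rpow (n : ℕ) (hp : 1 < p) (hd : 0 < (n : ℝ) - α * p)
    (hq : 0 < q) (hqp : q < p - 1) :
    ∃ C : ℝ≥0∞, C ≠ ∞ ∧ ∀ (σ : Measure (EuclideanSpace ℝ (Fin n))) (u : EuclideanSpace ℝ (Fin n) → ℝ≥0∞),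
      (∀ᵐ y ∂σ, wolffPotential α p (σ.withDensity fun z => u z ^ q) y ≤ u y) →
      (σ.withDensity fun z => u z ^ q) ≠ 0 → ∀ x,
      dyadicWolff ((n : ℝ) - α * p) (1 / (p - 1)) (σ.withDensity fun z => u z ^ q) x ≠ ∞ →
      dyadicWolff ((n : ℝ) - α * p) (1 / (p - 1)) σ x ≤
        C * dyadicWolff ((n : ℝ) - α * p) (1 / (p - 1)) (σ.withDensity fun z => u z ^ q) x ^
          (1 - q * (1 / (p - 1))) := by
  have hp' : 0 < p - 1 := sub_pos.2 hp
  have hs : 0 < 1 / (p - 1) := by positivity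
  set d := (n : ℝ) - α * p with hd_def
  set s := 1 / (p - 1) with hs_def
  set γ := q * s with hγ_def
  have hγ0 : 0 < γ := by positivity
  have hγ1 : γ < 1 := by rw [hγ_def, hs_def, mul_one_div, div_lt_one hp']; exact hqp
  obtain ⟨C, hC, H⟩ := exists_tsum_le_of_mul_intTail_rpow_le hγ0 hγ1
  set c : ℝ≥0∞ := 2 ^ (d * s) * 2 ^ (d * s + 1) with hc
  have hct : c ≠ ∞ := ENNReal.mul_ne_top (ENNReal.two_rpow_ne_top _) (ENNReal.two_rpow_ne_top _)
  have hc0 : c ≠ 0 := mul_ne_zero (ENNReal.two_rpow_ne_zero _) (ENNReal.two_rpow_ne_zero _)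
  have hcγt : c ^ γ ≠ ∞ := ENNReal.rpow_ne_top_of_nonneg hγ0.le hct
  have hcγ0 : c ^ γ ≠ 0 := (ENNReal.rpow_pos (pos_iff_ne_zero.2 hc0) hct).ne'
  refine ⟨c ^ γ * C, ENNReal.mul_ne_top hcγt hC, ?_⟩
  intro σ u hsup hω0 x hx
  set ω := σ.withDensity fun z => u z ^ q with hω
  have hterm : ∀ k, ballTerm d s σ x k * intTail (ballTerm d s ω x) k ^ γ ≤
      c ^ γ * ballTerm d s ω x k := fun k => by
    set T := intTail (ballTerm d s ω x) k
    have h1 : T ^ q * σ (Metric.ball x (2 ^ k)) ≤ c ^ q * ω (Metric.ball x (2 ^ k)) := by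
      rw [hω, withDensity_apply _ Metric.isOpen_ball.measurableSet,
        ← lintegral_const_mul' _ _ (ENNReal.rpow_ne_top_of_nonneg hq.le hct), ← setLIntegral_const]
      refine lintegral_mono_ae ?_
      filter_upwards [ae_restrict_of_ae hsup, ae_restrict_mem Metric.isOpen_ball.measurableSet]
        with y hy hyx
      rw [← ENNReal.mul_rpow_of_nonneg _ _ hq.le]
      refine ENNReal.rpow_le_rpow ?_ hq.le
      calc T ≤ 2 ^ (d * s) * dyadicWolff d s ω y := intTail_ballTerm_le_dyadicWolff hs.le hyx
        _ ≤ 2 ^ (d * s) * (2 ^ (d * s + 1) * u y) := by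
          gcongr
          refine (dyadicWolff_le_wolffPotential hp hd ω y).trans ?_
          gcongr
        _ = c * u y := by rw [hc]; ring
    rw [ballTerm, ballTerm, scaleTerm, scaleTerm, hγ_def, ENNReal.rpow_mul, ENNReal.rpow_mul,
      ← ENNReal.mul_rpow_of_nonneg _ _ hs.le, ← ENNReal.mul_rpow_of_nonneg _ _ hs.le]
    refine ENNReal.rpow_le_rpow ?_ hs.le
    calc _ = (T ^ q * σ (Metric.ball x (2 ^ k))) * 2 ^ (-(d * (k : ℝ))) := by ring
      _ ≤ (c ^ q * ω (Metric.ball x (2 ^ k))) * 2 ^ (-(d * (k : ℝ))) := by gcongr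
      _ = _ := by ring
  have key := H (ballTerm d s ω x) (fun k => (c ^ γ)⁻¹ * ballTerm d s σ x k)
    (intTail_ballTerm_ne_zero hs hω0 x) hx (fun k => by
      rw [mul_assoc]
      calc _ ≤ (c ^ γ)⁻¹ * (c ^ γ * ballTerm d s ω x k) := mul_le_mul_right (hterm k) _
        _ = _ := by rw [← mul_assoc, ENNReal.inv_mul_cancel hcγ0 hcγt, one_mul])
  rw [ENNReal.tsum_mul_left] at key
  calc dyadicWolff d s σ x = c ^ γ * ((c ^ γ)⁻¹ * dyadicWolff d s σ x) := by
        rw [← mul_assoc, ENNReal.mul_inv_cancel hcγ0 hcγt, one_mul]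
    _ ≤ c ^ γ * (C * dyadicWolff d s ω x ^ (1 - γ)) := mul_le_mul_right key _
    _ = _ := by ring

/-- The role of nontriviality: `u = 0` σ-a.e. forces `μ ≠ 0`, so `Wμ > 0` everywhere, and `u ≥ Wμ`
σ-a.e. is then possible only for `σ = 0`. -/
theorem withDensity_rpow_eq_zero_imp (hq : 0 < q) (hp : 1 < p) (hd : 0 < (n : ℝ) - α * p)
    {σ μ : Measure (EuclideanSpace ℝ (Fin n))} {u : EuclideanSpace ℝ (Fin n) → ℝ≥0∞} (hu : AEMeasurable u σ)
    (hsup : ∀ᵐ y ∂σ, wolffRHS α p q σ μ u y ≤ u y) (hnt : μ ≠ 0 ∨ ¬ ∀ᵐ y ∂σ, u y = 0)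
    (h : (σ.withDensity fun z => u z ^ q) = 0) : σ = 0 := by
  have hs : 0 < 1 / (p - 1) := by have := sub_pos.2 hp; positivity
  rw [withDensity_eq_zero_iff (hu.pow_const q)] at h
  have hu0 : ∀ᵐ y ∂σ, u y = 0 := by
    filter_upwards [h] with y hy
    exact (ENNReal.rpow_eq_zero_iff_of_pos hq).1 hy
  have hμ : μ ≠ 0 := hnt.resolve_right (not_not.2 hu0)
  have hF : ∀ᵐ y ∂σ, False := by
    filter_upwards [hu0, hsup] with y hy hy'
    rw [hy, wolffRHS] at hy'
    have h0 : wolffPotential α p μ y = 0 := by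
      have := (le_add_self.trans hy')
      exact le_antisymm this bot_le
    refine dyadicWolff_ne_zero (d := (n : ℝ) - α * p) hs hμ y (le_antisymm ?_ bot_le)
    refine (dyadicWolff_le_wolffPotential hp hd μ y).trans ?_
    rw [h0, mul_zero]
  rwa [Filter.eventually_false_iff_eq_bot, ae_eq_bot] at hF

theorem embeddingConst_zero (hq : 0 < q) (A : Set (EuclideanSpace ℝ (Fin n))) : embeddingConst α p q (0 : Measure (EuclideanSpace ℝ (Fin n))) A = 0 := by
  refine le_antisymm (sInf_le fun ν _ => ?_) bot_le
  simp [hq]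

theorem exists_wolffBound_le (n : ℕ) (hp : 1 < p) (hd : 0 < (n : ℝ) - α * p)
    (hq : 0 < q) (hqp : q < p - 1) :
    ∃ C : ℝ≥0∞, C ≠ ∞ ∧ ∀ (σ μ : Measure (EuclideanSpace ℝ (Fin n))) (u : EuclideanSpace ℝ (Fin n) → ℝ≥0∞), AEMeasurable u σ →
      (∀ᵐ y ∂σ, wolffRHS α p q σ μ u y ≤ u y) → (μ ≠ 0 ∨ ¬ ∀ᵐ y ∂σ, u y = 0) →
      ∀ x, wolffRHS α p q σ μ u x < ∞ →
        wolffBound α p q σ μ x ≤ C * wolffRHS α p q σ μ u x := by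
  have hp' : 0 < p - 1 := sub_pos.2 hp
  have hpq : 0 < p - 1 - q := by linarith
  have hs : 0 < 1 / (p - 1) := by positivity
  have hr : 0 < (p - 1) / (p - 1 - q) := by positivity
  have he : 0 < q * (p - 1) / (p - 1 - q) := by positivity
  obtain ⟨C₁, hC₁, H₁⟩ := exists_embeddingConst_rpow_le n hp hd hq hqp
  obtain ⟨C₂, hC₂, H₂⟩ := exists_dyadicWolff_le_rpow n hp hd hq hqp
  set d := (n : ℝ) - α * p with hd_def
  set s := 1 / (p - 1) with hs_def
  set K : ℝ≥0∞ := (2 ^ (d * s) * C₂) ^ ((p - 1) / (p - 1 - q)) * 2 ^ (d * s + 1) with hK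
  have hKt : K ≠ ∞ := ENNReal.mul_ne_top (ENNReal.rpow_ne_top_of_nonneg hr.le
    (ENNReal.mul_ne_top (ENNReal.two_rpow_ne_top _) hC₂)) (ENNReal.two_rpow_ne_top _)
  have hC₁s : C₁ ^ s ≠ ∞ := ENNReal.rpow_ne_top_of_nonneg hs.le hC₁
  refine ⟨K + C₁ ^ s + 1, by simp [hKt, hC₁s], ?_⟩
  intro σ μ u hu hsup hnt x hx
  set ω := σ.withDensity fun z => u z ^ q with hω
  have hWω : wolffPotential α p ω x < ∞ := lt_of_le_of_lt le_self_add hx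
  suffices h : wolffPotential α p σ x ^ ((p - 1) / (p - 1 - q)) ≤ K * wolffPotential α p ω x ∧
      intrinsicPotential α p q σ x ≤ C₁ ^ s * wolffPotential α p ω x by
    calc wolffBound α p q σ μ x ≤ K * wolffPotential α p ω x + C₁ ^ s * wolffPotential α p ω x +
          1 * wolffPotential α p μ x := by
          rw [wolffBound, one_mul]
          exact add_le_add (add_le_add h.1 h.2) le_rfl
      _ ≤ K * wolffRHS α p q σ μ u x + C₁ ^ s * wolffRHS α p q σ μ u x +
          1 * wolffRHS α p q σ μ u x := by
          have h1 : wolffPotential α p ω x ≤ wolffRHS α p q σ μ u x := le_self_add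
          have h2 : wolffPotential α p μ x ≤ wolffRHS α p q σ μ u x := le_add_self
          gcongr
      _ = _ := by ring
  by_cases hω0 : ω = 0
  · have hσ : σ = 0 := withDensity_rpow_eq_zero_imp hq hp hd hu hsup hnt hω0
    rw [hω0, hσ, wolffPotential_zero hp]
    constructor
    · simp [ENNReal.zero_rpow_of_pos hr]
    · simp [intrinsicPotential, embeddingConst_zero hq, ENNReal.zero_rpow_of_pos he, hp']
  have hDω : dyadicWolff d s ω x ≠ ∞ := ne_top_of_le_ne_top
    (ENNReal.mul_ne_top (ENNReal.two_rpow_ne_top _) hWω.ne)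
    (dyadicWolff_le_wolffPotential hp hd ω x)
  have hsup' : ∀ᵐ y ∂σ, wolffPotential α p ω y ≤ u y := by
    filter_upwards [hsup] with y hy
    exact le_self_add.trans hy
  constructor
  · have h1 := H₂ σ u hsup' hω0 x hDω
    have hexp : (1 - q * s) * ((p - 1) / (p - 1 - q)) = 1 := by
      rw [hs_def]; field_simp
    calc wolffPotential α p σ x ^ ((p - 1) / (p - 1 - q))
        ≤ (2 ^ (d * s) * C₂ * dyadicWolff d s ω x ^ (1 - q * s)) ^ ((p - 1) / (p - 1 - q)) := by
          refine ENNReal.rpow_le_rpow ?_ hr.le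
          refine (wolffPotential_le_dyadicWolff hp hd σ x).trans ?_
          rw [mul_assoc]
          gcongr
      _ = (2 ^ (d * s) * C₂) ^ ((p - 1) / (p - 1 - q)) * dyadicWolff d s ω x := by
          rw [ENNReal.mul_rpow_of_nonneg _ _ hr.le, ← ENNReal.rpow_mul (dyadicWolff d s ω x),
            hexp, ENNReal.rpow_one]
      _ ≤ (2 ^ (d * s) * C₂) ^ ((p - 1) / (p - 1 - q)) *
            (2 ^ (d * s + 1) * wolffPotential α p ω x) := by
          gcongr; exact dyadicWolff_le_wolffPotential hp hd ω x
      _ = _ := by rw [hK]; ring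
  -- A finite value `Wω(x)` makes `ω` finite on all balls about `x`, hence on every ball.
  · have hfin : ∀ y, ∀ k : ℤ, ω (Metric.ball y (2 ^ k)) ≠ ∞ := fun y k => by
      obtain ⟨j, hj⟩ := pow_unbounded_of_one_lt ((2 : ℝ) ^ k + dist y x) one_lt_two
      refine ne_top_of_le_ne_top
        (measure_ball_ne_top_of_dyadicWolff_ne_top hs hDω (j : ℤ)) (measure_mono ?_)
      exact Metric.ball_subset_ball' (by simpa using hj.le)
    rw [intrinsicPotential, wolffPotential, ← lintegral_const_mul' _ _ hC₁s]
    refine lintegral_mono fun t => ?_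
    rw [← mul_div_assoc, ← ENNReal.mul_rpow_of_nonneg _ _ hs.le, ← mul_div_assoc]
    gcongr
    exact H₁ σ u hu hsup' hω0 hfin _ Metric.isOpen_ball.measurableSet

end Wolff

/-! ### The upper bound for subsolutions. -/

section WolffUpper

variable {n : ℕ} {p α q : ℝ}

theorem embeddingConst_spec (hp : 1 < p) (hq : 0 < q) (σ ν : Measure (EuclideanSpace ℝ (Fin n)))
    (A : Set (EuclideanSpace ℝ (Fin n))) [IsFiniteMeasure ν] :
    ∫⁻ y, wolffPotential α p ν y ^ q ∂(σ.restrict A) ≤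
      (embeddingConst α p q σ A * ν Set.univ ^ (1 / (p - 1))) ^ q := by
  have hs : 0 < 1 / (p - 1) := by have := sub_pos.2 hp; positivity
  rw [← ENNReal.rpow_inv_le_iff hq, ← one_div]
  rcases eq_or_ne (ν Set.univ) 0 with h0 | h0
  · rw [Measure.measure_univ_eq_zero] at h0
    simp [h0, wolffPotential_zero hp, hq]
  · have ht : ν Set.univ ^ (1 / (p - 1)) ≠ ∞ :=
      ENNReal.rpow_ne_top_of_nonneg hs.le (measure_ne_top ν _)
    have h0' : ν Set.univ ^ (1 / (p - 1)) ≠ 0 :=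
      (ENNReal.rpow_pos (pos_iff_ne_zero.2 h0) (measure_ne_top ν _)).ne'
    rw [← ENNReal.div_le_iff h0' ht]
    refine le_sInf fun k hk => ?_
    rw [ENNReal.div_le_iff h0' ht]
    exact hk ν inferInstance

theorem embeddingConst_mono (hq : 0 < q) (σ : Measure (EuclideanSpace ℝ (Fin n)))
    {A B : Set (EuclideanSpace ℝ (Fin n))} (h : A ⊆ B) :
    embeddingConst α p q σ A ≤ embeddingConst α p q σ B := by
  refine le_sInf fun k hk => sInf_le fun ν hν => le_trans ?_ (hk ν hν)
  exact ENNReal.rpow_le_rpow (lintegral_mono' (Measure.restrict_mono h le_rfl) le_rfl)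
    (by positivity)

theorem tsum_scaleTerm_embeddingConst_le (hp : 1 < p) (hd : 0 < (n : ℝ) - α * p) (hq : 0 < q)
    (hpq : 0 < p - 1 - q) (σ : Measure (EuclideanSpace ℝ (Fin n))) (x : EuclideanSpace ℝ (Fin n)) :
    ∑' k, scaleTerm ((n : ℝ) - α * p) (1 / (p - 1)) (fun t =>
      embeddingConst α p q σ (Metric.ball x t) ^ (q * (p - 1) / (p - 1 - q))) k ≤
      2 ^ (((n : ℝ) - α * p) * (1 / (p - 1)) + 1) * intrinsicPotential α p q σ x := by
  have hp' : 0 < p - 1 := sub_pos.2 hp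
  refine tsum_le_radialIntegral hd.le (by positivity) fun a b h => ?_
  exact ENNReal.rpow_le_rpow (embeddingConst_mono hq σ (Metric.ball_subset_ball h)) (by positivity)

/-- Localising `θ = ω + μ` to `B(x,2^(k+1))` gives a finite measure on which `κ` can be tested; the
rest contributes at most a multiple of the tail at `x`, constant on the ball. -/
theorem exists_measure_ball_le (n : ℕ) (hp : 1 < p) (hd : 0 < (n : ℝ) - α * p)
    (hq : 0 < q) :
    ∃ c : ℝ≥0∞, c ≠ 0 ∧ c ≠ ∞ ∧ ∀ (σ μ : Measure (EuclideanSpace ℝ (Fin n)))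
      (u : EuclideanSpace ℝ (Fin n) → ℝ≥0∞),
      (∀ᵐ y ∂σ, u y ≤ wolffRHS α p q σ μ u y) → ∀ x (k : ℤ),
      ((σ.withDensity fun z => u z ^ q) + μ) (Metric.ball x (2 ^ (k + 1))) ≠ ∞ →
      (σ.withDensity fun z => u z ^ q) (Metric.ball x (2 ^ k)) ≤
        c * (embeddingConst α p q σ (Metric.ball x (2 ^ k)) ^ q *
          ((σ.withDensity fun z => u z ^ q) + μ) (Metric.ball x (2 ^ (k + 1))) ^
            (q * (1 / (p - 1))) +
          intTail (ballTerm ((n : ℝ) - α * p) (1 / (p - 1))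
            ((σ.withDensity fun z => u z ^ q) + μ) x) k ^ q * σ (Metric.ball x (2 ^ k))) := by
  have hp' : 0 < p - 1 := sub_pos.2 hp
  have hs : 0 < 1 / (p - 1) := by positivity
  set d := (n : ℝ) - α * p with hd_def
  set s := 1 / (p - 1) with hs_def
  set c : ℝ≥0∞ := 2 ^ (d * s) * 2 * 2 ^ (d * s + 1) with hc
  have hct : c ≠ ∞ := ENNReal.mul_ne_top (ENNReal.mul_ne_top (ENNReal.two_rpow_ne_top _)
    (by simp)) (ENNReal.two_rpow_ne_top _)
  have hc0 : c ≠ 0 := mul_ne_zero (mul_ne_zero (ENNReal.two_rpow_ne_zero _)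
    (by simp)) (ENNReal.two_rpow_ne_zero _)
  have hc' : c ^ q * 2 ^ q ≠ ∞ :=
    ENNReal.mul_ne_top (ENNReal.rpow_ne_top_of_nonneg hq.le hct) (ENNReal.two_rpow_ne_top _)
  refine ⟨c ^ q * 2 ^ q, mul_ne_zero (ENNReal.rpow_pos (pos_iff_ne_zero.2 hc0) hct).ne'
    (ENNReal.two_rpow_ne_zero _), hc', ?_⟩
  intro σ μ u hsub x k hfin
  set ω := σ.withDensity fun z => u z ^ q with hω
  set θ := ω + μ with hθ
  set θ₁ := θ.restrict (Metric.ball x (2 ^ (k + 1))) with hθ₁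
  have : IsFiniteMeasure θ₁ := ⟨by rw [hθ₁, Measure.restrict_apply_univ]; exact hfin.lt_top⟩
  set T := intTail (ballTerm d s θ x) k
  have hball : MeasurableSet (Metric.ball x ((2 : ℝ) ^ k)) := Metric.isOpen_ball.measurableSet
  have hpt : ∀ y ∈ Metric.ball x ((2 : ℝ) ^ k), u y ≤ wolffRHS α p q σ μ u y →
      u y ^ q ≤ c ^ q * 2 ^ q * (wolffPotential α p θ₁ y ^ q + T ^ q) := fun y hy hu => by
    have h1 : u y ≤ c * (wolffPotential α p θ₁ y + T) := by
      calc u y ≤ 2 ^ (d * s) * dyadicWolff d s ω y + 2 ^ (d * s) * dyadicWolff d s μ y :=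
            hu.trans (add_le_add (wolffPotential_le_dyadicWolff hp hd ω y)
              (wolffPotential_le_dyadicWolff hp hd μ y))
        _ ≤ 2 ^ (d * s) * dyadicWolff d s θ y + 2 ^ (d * s) * dyadicWolff d s θ y := by
            have h2 := dyadicWolff_mono (d := d) hs.le (Measure.le_add_right (ν' := μ) (le_refl ω)) y
            have h3 := dyadicWolff_mono (d := d) hs.le (Measure.le_add_left (ν' := ω) (le_refl μ)) y
            gcongr
        _ = 2 ^ (d * s) * 2 * dyadicWolff d s θ y := by ring
        _ ≤ 2 ^ (d * s) * 2 * (2 ^ (d * s + 1) * wolffPotential α p θ₁ y +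
              2 ^ (d * s + 1) * T) := by
            refine mul_le_mul_right ((dyadicWolff_le_restrict_add hs.le hy).trans ?_) _
            refine add_le_add (dyadicWolff_le_wolffPotential hp hd θ₁ y) (mul_le_mul_left ?_ _)
            exact ENNReal.rpow_le_rpow_of_exponent_le (by norm_num) (by linarith)
        _ = _ := by rw [hc]; ring
    calc u y ^ q ≤ (c * (wolffPotential α p θ₁ y + T)) ^ q := ENNReal.rpow_le_rpow h1 hq.le
      _ = c ^ q * (wolffPotential α p θ₁ y + T) ^ q := ENNReal.mul_rpow_of_nonneg _ _ hq.le
      _ ≤ c ^ q * (2 ^ q * (wolffPotential α p θ₁ y ^ q + T ^ q)) :=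
          mul_le_mul_right (ENNReal.add_rpow_le_two_rpow_mul _ _ hq.le) _
      _ = _ := by ring
  calc ω (Metric.ball x (2 ^ k)) = ∫⁻ y in Metric.ball x (2 ^ k), u y ^ q ∂σ := by
        rw [hω, withDensity_apply _ hball]
    _ ≤ ∫⁻ y in Metric.ball x (2 ^ k),
          c ^ q * 2 ^ q * (wolffPotential α p θ₁ y ^ q + T ^ q) ∂σ := by
        refine lintegral_mono_ae ?_
        filter_upwards [ae_restrict_of_ae hsub, ae_restrict_mem hball] with y hy hyx
        exact hpt y hyx hy
    _ = c ^ q * 2 ^ q * (∫⁻ y in Metric.ball x (2 ^ k), wolffPotential α p θ₁ y ^ q ∂σ +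
          T ^ q * σ (Metric.ball x (2 ^ k))) := by
        rw [lintegral_const_mul' _ _ hc', lintegral_add_right _ measurable_const, setLIntegral_const]
    _ ≤ _ := by
        refine mul_le_mul_right (add_le_add ?_ le_rfl) _
        refine (embeddingConst_spec hp hq σ θ₁ _).trans (le_of_eq ?_)
        rw [ENNReal.mul_rpow_of_nonneg _ _ hq.le, hθ₁, Measure.restrict_apply_univ,
          ← ENNReal.rpow_mul, mul_comm q]

theorem exists_wolffRHS_le (n : ℕ) (hp : 1 < p) (hd : 0 < (n : ℝ) - α * p)
    (hq : 0 < q) (hqp : q < p - 1) :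
    ∃ C : ℝ≥0∞, C ≠ ∞ ∧ ∀ (σ μ : Measure (EuclideanSpace ℝ (Fin n)))
      (u : EuclideanSpace ℝ (Fin n) → ℝ≥0∞),
      (∀ᵐ y ∂σ, u y ≤ wolffRHS α p q σ μ u y) → ∀ x, wolffRHS α p q σ μ u x < ∞ →
        wolffRHS α p q σ μ u x ≤ C * wolffBound α p q σ μ x := by
  have hp' : 0 < p - 1 := sub_pos.2 hp
  have hpq : 0 < p - 1 - q := by linarith
  have hs : 0 < 1 / (p - 1) := by positivity
  have he : 0 < q * (p - 1) / (p - 1 - q) := by positivity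
  obtain ⟨c, hc0, hct, H⟩ := exists_measure_ball_le n hp hd hq
  set d := (n : ℝ) - α * p with hd_def
  set s := 1 / (p - 1) with hs_def
  set e := q * (p - 1) / (p - 1 - q) with he_def
  set γ := q * s with hγ_def
  set r := (p - 1) / (p - 1 - q) with hr_def
  have hr : 0 < r := by positivity
  have hγ0 : 0 < γ := by positivity
  have hγ1 : γ < 1 := by rw [hγ_def, hs_def, mul_one_div, div_lt_one hp']; exact hqp
  have hγ1' : 0 < 1 - γ := by linarith
  have hrγ : 1 / (1 - γ) = r := by
    rw [hγ_def, hs_def, hr_def, div_eq_div_iff (by rw [hγ_def, hs_def] at hγ1'; exact hγ1'.ne') hpq.ne']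
    field_simp
  have hqr : q * (1 / (1 - γ)) = e := by rw [hrγ, hr_def, he_def, mul_div_assoc]
  have hcs0 : c ^ s ≠ 0 := (ENNReal.rpow_pos (pos_iff_ne_zero.2 hc0) hct).ne'
  have hcst : c ^ s ≠ ∞ := ENNReal.rpow_ne_top_of_nonneg hs.le hct
  set A : ℝ≥0∞ := 2 ^ s * c ^ s * 2 ^ (d * s) with hA
  have hA0 : A ≠ 0 := mul_ne_zero (mul_ne_zero (ENNReal.two_rpow_ne_zero _) hcs0)
    (ENNReal.two_rpow_ne_zero _)
  have hAt : A ≠ ∞ := ENNReal.mul_ne_top (ENNReal.mul_ne_top (ENNReal.two_rpow_ne_top _) hcst)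
    (ENNReal.two_rpow_ne_top _)
  -- Two terms `ε₂ Dθ` will arise, with `Dθ ≤ 2^s (Dω + Dμ)` for the dyadic sums; this value makes
  -- their total at most `(Dω + Dμ)/2`.
  set ε₂ : ℝ≥0∞ := (2 ^ s * 4)⁻¹ with hε₂
  have h24 : (2 : ℝ≥0∞) ^ s * 4 ≠ 0 := mul_ne_zero (ENNReal.two_rpow_ne_zero _) (by simp)
  have h24t : (2 : ℝ≥0∞) ^ s * 4 ≠ ∞ := ENNReal.mul_ne_top (ENNReal.two_rpow_ne_top _) (by simp)
  have hε₂0 : ε₂ ≠ 0 := ENNReal.inv_ne_zero.2 h24t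
  have hε₂t : ε₂ ≠ ∞ := ENNReal.inv_ne_top.2 h24
  -- Solves `A ε^s = ε₂`, where `A ε^s` is the coefficient of the `θ`-term at each scale.
  set ε : ℝ≥0∞ := (ε₂ / A) ^ s⁻¹ with hε
  have hεs : ε ^ s = ε₂ / A := by rw [hε, ENNReal.rpow_inv_rpow hs.ne']
  have hεA0 : ε₂ / A ≠ 0 := (ENNReal.div_pos hε₂0 hAt).ne'
  have hεAt : ε₂ / A ≠ ∞ := ENNReal.div_ne_top hε₂t hA0
  have hε0 : ε ≠ 0 := (ENNReal.rpow_pos (pos_iff_ne_zero.2 hεA0) hεAt).ne'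
  have hεt : ε ≠ ∞ := ENNReal.rpow_ne_top_of_nonneg (inv_nonneg.2 hs.le) hεAt
  set D₁ : ℝ≥0∞ := ε⁻¹ ^ (γ / (1 - γ)) with hD₁
  have hγγ : 0 ≤ γ / (1 - γ) := by positivity
  have hD₁t : D₁ ≠ ∞ := ENNReal.rpow_ne_top_of_nonneg hγγ (ENNReal.inv_ne_top.2 hε0)
  set D₂ : ℝ≥0∞ := ε₂⁻¹ ^ (γ / (1 - γ)) with hD₂
  have hD₂t : D₂ ≠ ∞ := ENNReal.rpow_ne_top_of_nonneg hγγ (ENNReal.inv_ne_top.2 hε₂0)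
  set G₁ : ℝ≥0∞ := 2 ^ s * 2 ^ s * c ^ s * D₁ ^ s with hG₁
  have hG₁t : G₁ ≠ ∞ := ENNReal.mul_ne_top (ENNReal.mul_ne_top (ENNReal.mul_ne_top
    (ENNReal.two_rpow_ne_top _) (ENNReal.two_rpow_ne_top _)) hcst)
    (ENNReal.rpow_ne_top_of_nonneg hs.le hD₁t)
  set G₂ : ℝ≥0∞ := 2 ^ s * 2 ^ s * c ^ s with hG₂
  have hG₂t : G₂ ≠ ∞ := ENNReal.mul_ne_top (ENNReal.mul_ne_top
    (ENNReal.two_rpow_ne_top _) (ENNReal.two_rpow_ne_top _)) hcst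
  set G₃ : ℝ≥0∞ := D₂ * G₂ ^ r with hG₃
  have hG₃t : G₃ ≠ ∞ := ENNReal.mul_ne_top hD₂t (ENNReal.rpow_ne_top_of_nonneg hr.le hG₂t)
  set P : ℝ≥0∞ := 2 ^ (d * s + 1) with hP
  have hPt : P ≠ ∞ := ENNReal.two_rpow_ne_top _
  have hPr : P ^ r ≠ ∞ := ENNReal.rpow_ne_top_of_nonneg hr.le hPt
  set Q : ℝ≥0∞ := 2 ^ (d * s) with hQ
  have hQt : Q ≠ ∞ := ENNReal.two_rpow_ne_top _
  refine ⟨Q * (2 * G₃ * P ^ r) + Q * (2 * G₁ * P) + Q * (2 * P), by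
    simp [ENNReal.mul_eq_top, hQt, hG₃t, hPr, hG₁t, hPt], ?_⟩
  intro σ μ u hsub x hx
  set ω := σ.withDensity fun z => u z ^ q with hω
  have hWω : wolffPotential α p ω x < ∞ := lt_of_le_of_lt le_self_add hx
  have hWμ : wolffPotential α p μ x < ∞ := lt_of_le_of_lt le_add_self hx
  have hDω : dyadicWolff d s ω x ≠ ∞ := ne_top_of_le_ne_top
    (ENNReal.mul_ne_top hPt hWω.ne) (dyadicWolff_le_wolffPotential hp hd ω x)
  have hDμ : dyadicWolff d s μ x ≠ ∞ := ne_top_of_le_ne_top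
    (ENNReal.mul_ne_top hPt hWμ.ne) (dyadicWolff_le_wolffPotential hp hd μ x)
  set θ := ω + μ with hθ
  have hDθ : dyadicWolff d s θ x ≤ 2 ^ s * (dyadicWolff d s ω x + dyadicWolff d s μ x) :=
    dyadicWolff_add_le hs.le ω μ x
  have hDθt : dyadicWolff d s θ x ≠ ∞ := ne_top_of_le_ne_top
    (ENNReal.mul_ne_top (ENNReal.two_rpow_ne_top _) (ENNReal.add_ne_top.2 ⟨hDω, hDμ⟩)) hDθ
  set κ : ℝ → ℝ≥0∞ := fun t => embeddingConst α p q σ (Metric.ball x t) ^ e with hκ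
  -- The `κ`-term is split by Young at each scale; in the `σ`-term the tail is replaced by the full
  -- sum, and Young is applied only after summation.
  have hterm : ∀ k, ballTerm d s ω x k ≤ A * ε ^ s * ballTerm d s θ x (k + 1) +
      (G₁ * scaleTerm d s κ k + dyadicWolff d s θ x ^ γ * (G₂ * ballTerm d s σ x k)) := fun k => by
    set T := intTail (ballTerm d s θ x) k
    set w : ℝ≥0∞ := 2 ^ (-(d * (k : ℝ))) with hw
    have h1 : ω (Metric.ball x (2 ^ k)) ≤ c * (ε * θ (Metric.ball x (2 ^ (k + 1))) +
        (D₁ * κ (2 ^ k) + T ^ q * σ (Metric.ball x (2 ^ k)))) := by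
      refine (H σ μ u hsub x k (measure_ball_ne_top_of_dyadicWolff_ne_top hs hDθt _)).trans ?_
      rw [← add_assoc]
      refine mul_le_mul_right (add_le_add ?_ le_rfl) _
      have := ENNReal.mul_rpow_le_young (embeddingConst α p q σ (Metric.ball x (2 ^ k)) ^ q)
        (θ (Metric.ball x (2 ^ (k + 1)))) ε hγ0 hγ1 hε0 hεt
      rwa [← ENNReal.rpow_mul, hqr] at this
    have hTle : T ^ γ ≤ dyadicWolff d s θ x ^ γ :=
      ENNReal.rpow_le_rpow (intTail_le_tsum _ _) hγ0.le
    calc ballTerm d s ω x k ≤ (c * (ε * θ (Metric.ball x (2 ^ (k + 1))) +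
          (D₁ * κ (2 ^ k) + T ^ q * σ (Metric.ball x (2 ^ k)))) * w) ^ s :=
          ENNReal.rpow_le_rpow (mul_le_mul_left h1 _) hs.le
      _ = (c * ε * (θ (Metric.ball x (2 ^ (k + 1))) * w) +
          (c * D₁ * (κ (2 ^ k) * w) + c * T ^ q * (σ (Metric.ball x (2 ^ k)) * w))) ^ s := by
          congr 1; ring
      _ ≤ 2 ^ s * ((c * ε * (θ (Metric.ball x (2 ^ (k + 1))) * w)) ^ s + 2 ^ s *
          ((c * D₁ * (κ (2 ^ k) * w)) ^ s + (c * T ^ q * (σ (Metric.ball x (2 ^ k)) * w)) ^ s)) :=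
          (ENNReal.add_rpow_le_two_rpow_mul _ _ hs.le).trans (mul_le_mul_right
            (add_le_add le_rfl (ENNReal.add_rpow_le_two_rpow_mul _ _ hs.le)) _)
      _ = A * ε ^ s * ballTerm d s θ x (k + 1) +
          (G₁ * scaleTerm d s κ k + T ^ γ * (G₂ * ballTerm d s σ x k)) := by
          simp only [ENNReal.mul_rpow_of_nonneg (c * ε) _ hs.le,
            ENNReal.mul_rpow_of_nonneg (c * D₁) _ hs.le,
            ENNReal.mul_rpow_of_nonneg (c * T ^ q) _ hs.le, ENNReal.mul_rpow_of_nonneg c _ hs.le]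
          rw [scaleTerm_succ hs.le (fun t => θ (Metric.ball x t)) k, ← ENNReal.rpow_mul T]
          simp only [ballTerm, scaleTerm, hA, hG₁, hG₂]
          ring
      _ ≤ _ := by gcongr
  have hyoung : dyadicWolff d s θ x ^ γ * (G₂ * dyadicWolff d s σ x) ≤
      ε₂ * dyadicWolff d s θ x + G₃ * dyadicWolff d s σ x ^ r := by
    rw [mul_comm]
    refine (ENNReal.mul_rpow_le_young _ _ ε₂ hγ0 hγ1 hε₂0 hε₂t).trans (le_of_eq ?_)
    rw [hrγ, ENNReal.mul_rpow_of_nonneg _ _ hr.le, hG₃, mul_assoc]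
  set R := G₁ * ∑' k, scaleTerm d s κ k + G₃ * dyadicWolff d s σ x ^ r with hR
  have hsum : dyadicWolff d s ω x ≤ 2⁻¹ * (dyadicWolff d s ω x + dyadicWolff d s μ x) + R := by
    calc dyadicWolff d s ω x ≤ _ := ENNReal.tsum_le_tsum hterm
      _ = A * ε ^ s * dyadicWolff d s θ x + (G₁ * ∑' k, scaleTerm d s κ k +
            dyadicWolff d s θ x ^ γ * (G₂ * dyadicWolff d s σ x)) := by
          have hshift : ∑' k : ℤ, ballTerm d s θ x (k + 1) = dyadicWolff d s θ x :=
            (Equiv.addRight (1 : ℤ)).tsum_eq (ballTerm d s θ x)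
          rw [ENNReal.tsum_add, ENNReal.tsum_add, ENNReal.tsum_mul_left, ENNReal.tsum_mul_left,
            ENNReal.tsum_mul_left, ENNReal.tsum_mul_left, hshift]
          rfl
      _ ≤ ε₂ * dyadicWolff d s θ x + (G₁ * ∑' k, scaleTerm d s κ k +
            (ε₂ * dyadicWolff d s θ x + G₃ * dyadicWolff d s σ x ^ r)) := by
          rw [hεs, ENNReal.mul_div_cancel hA0 hAt]
          gcongr
      _ = (ε₂ * 2) * dyadicWolff d s θ x + R := by rw [hR]; ring
      _ ≤ (ε₂ * 2) * (2 ^ s * (dyadicWolff d s ω x + dyadicWolff d s μ x)) + R := by gcongr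
      _ = _ := by
          rw [← mul_assoc]
          congr 2
          have h4 : (2 : ℝ≥0∞) * 2 = 4 := by norm_num
          rw [hε₂, ENNReal.mul_inv (Or.inl (ENNReal.two_rpow_ne_zero _)) (Or.inr (by simp)), ← h4,
            ENNReal.mul_inv (by simp) (by simp)]
          have h2 : (2 : ℝ≥0∞)⁻¹ * 2 = 1 := ENNReal.inv_mul_cancel (by simp) (by simp)
          have h2s : ((2 : ℝ≥0∞) ^ s)⁻¹ * 2 ^ s = 1 :=
            ENNReal.inv_mul_cancel (ENNReal.two_rpow_ne_zero _) (ENNReal.two_rpow_ne_top _)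
          calc _ = 2⁻¹ * ((2 : ℝ≥0∞)⁻¹ * 2) * (((2 : ℝ≥0∞) ^ s)⁻¹ * 2 ^ s) := by ring
            _ = _ := by rw [h2, h2s]; simp
  -- Absorption: cancelling the sum for `ω` is legitimate because it is finite at `x`.
  have habs : dyadicWolff d s ω x ≤ dyadicWolff d s μ x + 2 * R := by
    have h2 : (2 : ℝ≥0∞) * 2⁻¹ = 1 := ENNReal.mul_inv_cancel (by simp) (by simp)
    have h3 : 2 * dyadicWolff d s ω x ≤
        dyadicWolff d s ω x + (dyadicWolff d s μ x + 2 * R) := by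
      calc _ ≤ 2 * (2⁻¹ * (dyadicWolff d s ω x + dyadicWolff d s μ x) + R) := by gcongr
        _ = 2 * 2⁻¹ * (dyadicWolff d s ω x + dyadicWolff d s μ x) + 2 * R := by ring
        _ = _ := by rw [h2]; ring
    rw [two_mul] at h3
    exact (ENNReal.add_le_add_iff_left hDω).1 h3
  have hDκ : ∑' k, scaleTerm d s κ k ≤ P * intrinsicPotential α p q σ x :=
    tsum_scaleTerm_embeddingConst_le hp hd hq hpq σ x
  have hDσ : dyadicWolff d s σ x ^ r ≤ P ^ r * wolffPotential α p σ x ^ r := by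
    rw [← ENNReal.mul_rpow_of_nonneg _ _ hr.le]
    exact ENNReal.rpow_le_rpow (dyadicWolff_le_wolffPotential hp hd σ x) hr.le
  have hDμ' : dyadicWolff d s μ x ≤ P * wolffPotential α p μ x :=
    dyadicWolff_le_wolffPotential hp hd μ x
  calc wolffRHS α p q σ μ u x ≤ Q * dyadicWolff d s ω x + Q * dyadicWolff d s μ x :=
        add_le_add (wolffPotential_le_dyadicWolff hp hd ω x)
          (wolffPotential_le_dyadicWolff hp hd μ x)
    _ ≤ Q * (dyadicWolff d s μ x + 2 * R) + Q * dyadicWolff d s μ x := by gcongr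
    _ = Q * (2 * G₃) * dyadicWolff d s σ x ^ r + Q * (2 * G₁) * ∑' k, scaleTerm d s κ k +
          Q * 2 * dyadicWolff d s μ x := by rw [hR]; ring
    _ ≤ Q * (2 * G₃) * (P ^ r * wolffPotential α p σ x ^ r) +
          Q * (2 * G₁) * (P * intrinsicPotential α p q σ x) +
          Q * 2 * (P * wolffPotential α p μ x) := by gcongr
    _ = Q * (2 * G₃ * P ^ r) * wolffPotential α p σ x ^ r +
          Q * (2 * G₁ * P) * intrinsicPotential α p q σ x +
          Q * (2 * P) * wolffPotential α p μ x := by ring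
    _ ≤ _ := by
        set a := Q * (2 * G₃ * P ^ r)
        set b := Q * (2 * G₁ * P)
        set c' := Q * (2 * P)
        have ha : a ≤ a + b + c' := le_trans le_self_add le_self_add
        have hb : b ≤ a + b + c' := le_trans le_add_self le_self_add
        have hc' : c' ≤ a + b + c' := le_add_self
        rw [wolffBound, mul_add, mul_add]
        gcongr

end WolffUpper

/-! ### Infinity sets of Wolff potentials have capacity zero. -/

theorem intTail_le_tsum_nat (a : ℤ → ℝ≥0∞) (m : ℤ) : intTail a m ≤ ∑' j : ℕ, a (m + j) := by
  rw [intTail, ← (Equiv.addLeft m).tsum_eq,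
    tsum_of_nat_of_neg_add_one ENNReal.summable ENNReal.summable]
  have h : ∀ n : ℕ, (if m ≤ (Equiv.addLeft m) (-((n : ℤ) + 1)) then
      a ((Equiv.addLeft m) (-((n : ℤ) + 1))) else 0) = 0 := fun n => by
    rw [if_neg]; simp only [Equiv.coe_addLeft]; omega
  simp only [h, tsum_zero, add_zero]
  exact ENNReal.tsum_le_tsum fun n => by split_ifs <;> simp

/-- Discrete divergence of `∫ (1+T)^(-δ) dT` for `δ < 1`: the terms with `k ≥ m` sum to at least
`T_m (1+T_m)^(-δ)`, which is unbounded in `m`. -/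
theorem tsum_mul_one_add_intTail_rpow_eq_top (a : ℤ → ℝ≥0∞) (ha : ∑' k, a k = ∞)
    (hT : ∀ k, intTail a k ≠ ∞) {δ : ℝ} (h0 : 0 < δ) (h1 : δ < 1) :
    ∑' k, a k * ((1 + intTail a k)⁻¹) ^ δ = ∞ := by
  by_contra hS
  set S := ∑' k, a k * ((1 + intTail a k)⁻¹) ^ δ with hSdef
  have h1' : 0 < 1 - δ := by linarith
  have hlow : ∀ m, intTail a m * ((1 + intTail a m)⁻¹) ^ δ ≤ S := fun m => by
    nth_rewrite 1 [intTail]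
    rw [← ENNReal.tsum_mul_right, hSdef]
    refine ENNReal.tsum_le_tsum fun k => ?_
    split_ifs with hk
    · have := intTail_antitone a hk
      gcongr
    · simp
  have hbig : max 1 ((2 * S) ^ (1 / (1 - δ))) < ⨆ m, intTail a m := by
    rw [iSup_intTail, ha]
    exact max_lt (by simp) (ENNReal.rpow_lt_top_of_nonneg (by positivity)
      (ENNReal.mul_ne_top (by simp) hS))
  obtain ⟨m, hm⟩ := lt_iSup_iff.1 hbig
  set T := intTail a m
  have hT1 : 1 ≤ T := ((le_max_left _ _).trans_lt hm).le
  have hTS : 2 * S < T ^ (1 - δ) := by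
    have := (le_max_right _ _).trans_lt hm
    rwa [one_div, ENNReal.rpow_inv_lt_iff h1'] at this
  have hadd0 : 1 + T ≠ 0 := by simp
  have haddt : 1 + T ≠ ∞ := by simpa using hT m
  have : T ^ (1 - δ) ≤ 2 * S := by
    calc T ^ (1 - δ) ≤ (1 + T) ^ (1 - δ) := ENNReal.rpow_le_rpow le_add_self h1'.le
      _ = (1 + T) * ((1 + T)⁻¹) ^ δ := by
        rw [ENNReal.rpow_sub _ _ hadd0 haddt, ENNReal.rpow_one, ENNReal.inv_rpow, div_eq_mul_inv]
      _ ≤ (2 * T) * ((1 + T)⁻¹) ^ δ := by rw [two_mul]; gcongr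
      _ = 2 * (T * ((1 + T)⁻¹) ^ δ) := by ring
      _ ≤ 2 * S := by gcongr; exact hlow m
  exact absurd (hTS.trans_le this) (lt_irrefl _)

theorem ENNReal.iSup_rpow_le_tsum_rpow {ι : Type*} (g : ι → ℝ≥0∞) {p : ℝ} (hp : 0 < p) :
    (⨆ i, g i) ^ p ≤ ∑' i, g i ^ p := by
  rw [← ENNReal.le_rpow_inv_iff hp]
  refine iSup_le fun i => ?_
  rw [ENNReal.le_rpow_inv_iff hp]
  exact ENNReal.le_tsum i

section Capacity

variable {n : ℕ} {p α : ℝ}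

/-- A set on which the Riesz potential of some `L^p` function is infinite. -/
def IsRieszPolar (α p : ℝ) (A : Set (EuclideanSpace ℝ (Fin n))) : Prop :=
  ∃ f : EuclideanSpace ℝ (Fin n) → ℝ≥0∞, Measurable f ∧ ∫⁻ y, f y ^ p ≠ ∞ ∧
    ∀ x ∈ A, rieszPotential α f x = ∞

theorem rieszPotential_const_mul (f : EuclideanSpace ℝ (Fin n) → ℝ≥0∞) {c : ℝ≥0∞} (hc : c ≠ ∞)
    (x : EuclideanSpace ℝ (Fin n)) :
    rieszPotential α (fun y => c * f y) x = c * rieszPotential α f x := by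
  simp only [rieszPotential, mul_div_assoc]
  exact lintegral_const_mul' _ _ hc

theorem rieszPotential_mono {f g : EuclideanSpace ℝ (Fin n) → ℝ≥0∞} (h : ∀ y, f y ≤ g y)
    (x : EuclideanSpace ℝ (Fin n)) : rieszPotential α f x ≤ rieszPotential α g x :=
  lintegral_mono fun y => ENNReal.div_le_div_right (h y) _

theorem exists_ne_zero_rpow_mul_le (hp : 0 < p) {I ε : ℝ≥0∞} (hI : I ≠ ∞) (hε : ε ≠ 0)
    (hε' : ε ≠ ∞) : ∃ c : ℝ≥0∞, c ≠ 0 ∧ c ≠ ∞ ∧ c ^ p * I ≤ ε := by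
  have hI1 : I + 1 ≠ ∞ := by simp [hI]
  have hI0 : I + 1 ≠ 0 := by simp
  refine ⟨(ε / (I + 1)) ^ p⁻¹, ?_, ?_, ?_⟩
  · exact (ENNReal.rpow_pos (ENNReal.div_pos hε hI1) (ENNReal.div_ne_top hε' hI0)).ne'
  · exact ENNReal.rpow_ne_top_of_nonneg (by positivity) (ENNReal.div_ne_top hε' hI0)
  · rw [ENNReal.rpow_inv_rpow hp.ne']
    calc _ ≤ ε / (I + 1) * (I + 1) := by gcongr; exact le_self_add
      _ = ε := ENNReal.div_mul_cancel hI0 hI1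

theorem IsRieszPolar.rieszCapacity_eq_zero (hp : 0 < p) {A : Set (EuclideanSpace ℝ (Fin n))}
    (h : IsRieszPolar α p A) : rieszCapacity α p A = 0 := by
  obtain ⟨f, hf, hfi, hft⟩ := h
  refine le_antisymm (ENNReal.le_of_forall_pos_le_add fun ε hε _ => ?_) bot_le
  obtain ⟨c, hc0, hct, hc⟩ := exists_ne_zero_rpow_mul_le hp hfi
    (ENNReal.coe_ne_zero.2 hε.ne') ENNReal.coe_ne_top
  rw [zero_add]
  refine le_trans (iInf_le_of_le (fun y => c * f y) (iInf_le_of_le (hf.const_mul c)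
    (iInf_le_of_le (fun x hx => ?_) le_rfl))) (le_trans (le_of_eq ?_) hc)
  · rw [rieszPotential_const_mul f hct, hft x hx, ENNReal.mul_top hc0]; exact le_top
  · simp_rw [ENNReal.mul_rpow_of_nonneg _ _ hp.le]
    exact lintegral_const_mul' _ _ (ENNReal.rpow_ne_top_of_nonneg hp.le hct)

/-- Take the supremum of multiples `c_m f_m` whose `p`-th power integrals are summable. -/
theorem IsRieszPolar.iUnion (hp : 0 < p) {A : ℕ → Set (EuclideanSpace ℝ (Fin n))}
    (h : ∀ m, IsRieszPolar α p (A m)) : IsRieszPolar α p (⋃ m, A m) := by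
  choose f hf hfi hft using h
  obtain ⟨ε, hε, hεsum⟩ := ENNReal.exists_pos_sum_of_countable' one_ne_zero ℕ
  have hεt : ∀ m, ε m ≠ ∞ := fun m =>
    ne_top_of_le_ne_top ENNReal.one_ne_top ((ENNReal.le_tsum m).trans hεsum.le)
  have hch := fun m => exists_ne_zero_rpow_mul_le hp (hfi m) (hε m).ne' (hεt m)
  choose c hc0 hct hc using hch
  refine ⟨fun y => ⨆ m, c m * f m y, Measurable.iSup fun m => (hf m).const_mul _, ?_, ?_⟩
  · refine ne_top_of_le_ne_top ENNReal.one_ne_top (le_trans ?_ hεsum.le)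
    calc ∫⁻ y, (⨆ m, c m * f m y) ^ p ≤ ∫⁻ y, ∑' m, (c m * f m y) ^ p :=
          lintegral_mono fun y => ENNReal.iSup_rpow_le_tsum_rpow _ hp
      _ = ∑' m, ∫⁻ y, (c m * f m y) ^ p :=
          lintegral_tsum fun m => (((hf m).const_mul _).pow_const p).aemeasurable
      _ ≤ ∑' m, ε m := ENNReal.tsum_le_tsum fun m => by
          refine le_trans (le_of_eq ?_) (hc m)
          simp_rw [ENNReal.mul_rpow_of_nonneg _ _ hp.le]
          exact lintegral_const_mul' _ _ (ENNReal.rpow_ne_top_of_nonneg hp.le (hct m))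
  · intro x hx
    obtain ⟨m, hm⟩ := Set.mem_iUnion.1 hx
    refine top_unique (le_trans (le_of_eq ?_) (rieszPotential_mono
      (f := fun y => c m * f m y) (fun y => le_iSup (fun m => c m * f m y) m) x))
    rw [rieszPotential_const_mul _ (hct m), hft m x hm, ENNReal.mul_top (hc0 m)]

theorem IsRieszPolar.mono {A B : Set (EuclideanSpace ℝ (Fin n))} (h : A ⊆ B)
    (hB : IsRieszPolar α p B) : IsRieszPolar α p A := by
  obtain ⟨f, hf, hfi, hft⟩ := hB
  exact ⟨f, hf, hfi, fun x hx => hft x (h hx)⟩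

theorem volume_ball_two_zpow (x : EuclideanSpace ℝ (Fin n)) (k : ℤ) :
    volume (Metric.ball x ((2 : ℝ) ^ k)) =
      2 ^ ((n : ℝ) * k) * volume (Metric.ball (0 : EuclideanSpace ℝ (Fin n)) 1) := by
  rw [Measure.addHaar_ball_of_pos _ _ (by positivity), finrank_euclideanSpace_fin, ← Real.rpow_natCast,
    ENNReal.ofReal_two_zpow_rpow]

theorem volume_ball_le_volume_annulus (hn : 1 ≤ n) (x : EuclideanSpace ℝ (Fin n)) (k : ℤ) :
    volume (Metric.ball x ((2 : ℝ) ^ (k - 1))) ≤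
      volume (Metric.ball x ((2 : ℝ) ^ k) \ Metric.ball x (2 ^ (k - 1))) := by
  have hsub : Metric.ball x ((2 : ℝ) ^ (k - 1)) ⊆ Metric.ball x (2 ^ k) :=
    Metric.ball_subset_ball (zpow_le_zpow_right₀ one_le_two (by omega))
  have hfin : volume (Metric.ball x ((2 : ℝ) ^ (k - 1))) ≠ ∞ := measure_ball_lt_top.ne
  rw [measure_sdiff hsub Metric.isOpen_ball.measurableSet.nullMeasurableSet hfin]
  refine ENNReal.le_sub_of_add_le_left hfin ?_
  rw [← two_mul, volume_ball_two_zpow, volume_ball_two_zpow, ← mul_assoc]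
  gcongr
  nth_rewrite 1 [← ENNReal.rpow_one 2]
  rw [← ENNReal.two_rpow_add]
  refine ENNReal.rpow_le_rpow_of_exponent_le (by norm_num) ?_
  push_cast
  have : (1 : ℝ) ≤ n := by exact_mod_cast hn
  linarith

theorem tsum_setLIntegral_annulus_le (x : EuclideanSpace ℝ (Fin n))
    (F : EuclideanSpace ℝ (Fin n) → ℝ≥0∞) :
    ∑' k : ℤ, ∫⁻ y in Metric.ball x ((2 : ℝ) ^ k) \ Metric.ball x (2 ^ (k - 1)), F y ≤
      ∫⁻ y, F y := by
  rw [← lintegral_iUnion]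
  · exact setLIntegral_le_lintegral _ _
  · exact fun k => Metric.isOpen_ball.measurableSet.diff Metric.isOpen_ball.measurableSet
  · have key : ∀ j k : ℤ, j < k → Disjoint
        (Metric.ball x ((2 : ℝ) ^ j) \ Metric.ball x (2 ^ (j - 1)))
        (Metric.ball x ((2 : ℝ) ^ k) \ Metric.ball x (2 ^ (k - 1))) := fun j k hjk => by
      refine Set.disjoint_left.2 fun y hy hy' => hy'.2 ?_
      exact Metric.ball_subset_ball (zpow_le_zpow_right₀ one_le_two (by omega)) hy.1
    intro j k hjk
    rcases lt_or_gt_of_ne hjk with h | h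
    · exact key j k h
    · exact (key k j h).symm

variable {d s : ℝ}

theorem inv_one_add_le_of_le_mul (hds : 0 ≤ d * s) {t t' : ℝ≥0∞} (h : t ≤ 2 ^ (d * s) * t') :
    (1 + t')⁻¹ ≤ 2 ^ (d * s) * (1 + t)⁻¹ := by
  have hone : (1 : ℝ≥0∞) ≤ 2 ^ (d * s) := by
    rw [← ENNReal.rpow_zero (x := 2)]
    exact ENNReal.rpow_le_rpow_of_exponent_le (by norm_num) hds
  have h1 : 1 + t ≤ 2 ^ (d * s) * (1 + t') := by
    rw [mul_add, mul_one]
    exact add_le_add hone h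
  have h2 := ENNReal.inv_le_inv.2 h1
  rw [ENNReal.mul_inv (Or.inl (ENNReal.two_rpow_ne_zero _))
    (Or.inl (ENNReal.two_rpow_ne_top _))] at h2
  calc (1 + t')⁻¹ = 2 ^ (d * s) * ((2 ^ (d * s))⁻¹ * (1 + t')⁻¹) := by
        rw [← mul_assoc, ENNReal.mul_inv_cancel (ENNReal.two_rpow_ne_zero _)
          (ENNReal.two_rpow_ne_top _), one_mul]
    _ ≤ _ := mul_le_mul_right h2 _

/-- The dyadic terms damped by a power of the tail. -/
noncomputable def dampedTerm (d s r : ℝ) (θ : Measure (EuclideanSpace ℝ (Fin n)))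
    (y : EuclideanSpace ℝ (Fin n)) (k : ℤ) : ℝ≥0∞ :=
  ballTerm d s θ y k * ((1 + intTail (ballTerm d s θ y) k)⁻¹) ^ r

theorem measurable_intTail_ballTerm (θ : Measure (EuclideanSpace ℝ (Fin n))) (k : ℤ) :
    Measurable fun y => intTail (ballTerm d s θ y) k := by
  unfold intTail
  refine Measurable.tsum fun j => ?_
  split_ifs
  · exact measurable_ballTerm θ j
  · exact measurable_const

theorem measurable_dampedTerm (r : ℝ) (θ : Measure (EuclideanSpace ℝ (Fin n))) (k : ℤ) :
    Measurable fun y => dampedTerm d s r θ y k :=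
  (measurable_ballTerm θ k).mul
    (((measurable_intTail_ballTerm θ k).const_add 1).inv.pow_const r)

theorem dampedTerm_le (hd : 0 ≤ d) (hs : 0 ≤ s) {r : ℝ} (hr : 0 ≤ r)
    (θ : Measure (EuclideanSpace ℝ (Fin n))) {x y : EuclideanSpace ℝ (Fin n)} {k : ℤ}
    (h : dist y x < 2 ^ k) :
    dampedTerm d s r θ x k ≤
      2 ^ (d * s) * (2 ^ (d * s)) ^ r * dampedTerm d s r θ y (k + 1) := by
  have hds : 0 ≤ d * s := mul_nonneg hd hs
  have h' : dist x y < 2 ^ (k + 1) := by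
    rw [dist_comm]
    exact h.trans_le (zpow_le_zpow_right₀ one_le_two (by omega))
  have hT : intTail (ballTerm d s θ y) (k + 1) ≤ 2 ^ (d * s) * intTail (ballTerm d s θ x) k :=
    (intTail_ballTerm_le hs h').trans
      (mul_le_mul_right (intTail_antitone _ (by omega)) _)
  have h1 := ENNReal.rpow_le_rpow (inv_one_add_le_of_le_mul hds hT) hr
  rw [ENNReal.mul_rpow_of_nonneg _ _ hr] at h1
  calc dampedTerm d s r θ x k ≤ (2 ^ (d * s) * ballTerm d s θ y (k + 1)) *
        ((2 ^ (d * s)) ^ r * ((1 + intTail (ballTerm d s θ y) (k + 1))⁻¹) ^ r) :=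
        mul_le_mul' (ballTerm_le_ballTerm_succ hs h le_rfl) h1
    _ = _ := by rw [dampedTerm]; ring

/-- Write `θ(B(y,2^k))` as an integral in `z`, move the damped term from `y` to `z`, and use Fubini:
the `y`-integral is the volume of `B(z,2^k)`. -/
theorem lintegral_measure_ball_mul_dampedTerm_le (hd : 0 ≤ d) (hs : 0 ≤ s) {r : ℝ} (hr : 0 ≤ r)
    (θ : Measure (EuclideanSpace ℝ (Fin n))) [IsFiniteMeasure θ] (k : ℤ) :
    ∫⁻ y, θ (Metric.ball y (2 ^ k)) * dampedTerm d s r θ y k ≤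
      2 ^ (d * s) * (2 ^ (d * s)) ^ r * 2 ^ ((n : ℝ) * k) *
        volume (Metric.ball (0 : EuclideanSpace ℝ (Fin n)) 1) *
        ∫⁻ z, dampedTerm d s r θ z (k + 1) ∂θ := by
  set C : ℝ≥0∞ := 2 ^ (d * s) * (2 ^ (d * s)) ^ r with hC
  set S : Set (EuclideanSpace ℝ (Fin n) × EuclideanSpace ℝ (Fin n)) :=
    {w | dist w.2 w.1 < 2 ^ k} with hS
  have hSm : MeasurableSet S :=
    (isOpen_lt (continuous_snd.dist continuous_fst) continuous_const).measurableSet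
  set F : EuclideanSpace ℝ (Fin n) → EuclideanSpace ℝ (Fin n) → ℝ≥0∞ := fun y z =>
    S.indicator (fun w => C * dampedTerm d s r θ w.2 (k + 1)) (y, z) with hF
  have hFm : Measurable (Function.uncurry F) :=
    (((measurable_dampedTerm r θ (k + 1)).comp measurable_snd).const_mul C).indicator hSm
  have h1 : ∀ y, θ (Metric.ball y (2 ^ k)) * dampedTerm d s r θ y k ≤ ∫⁻ z, F y z ∂θ := fun y => by
    have hb : MeasurableSet (Metric.ball y ((2 : ℝ) ^ k)) := Metric.isOpen_ball.measurableSet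
    rw [mul_comm, ← lintegral_indicator_const hb]
    refine lintegral_mono fun z => ?_
    by_cases hz : dist z y < 2 ^ k
    · rw [Set.indicator_of_mem (show z ∈ Metric.ball y (2 ^ k) from hz)]
      simp only [hF]
      rw [Set.indicator_of_mem (show (y, z) ∈ S from hz)]
      exact dampedTerm_le hd hs hr θ hz
    · rw [Set.indicator_of_notMem (show z ∉ Metric.ball y (2 ^ k) from hz)]
      exact bot_le
  have h2 : ∀ z, ∫⁻ y, F y z = C * dampedTerm d s r θ z (k + 1) *
      (2 ^ ((n : ℝ) * k) * volume (Metric.ball (0 : EuclideanSpace ℝ (Fin n)) 1)) := fun z => by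
    have hb : MeasurableSet (Metric.ball z ((2 : ℝ) ^ k)) := Metric.isOpen_ball.measurableSet
    rw [← volume_ball_two_zpow z k, ← lintegral_indicator_const hb]
    refine lintegral_congr fun y => ?_
    simp only [hF, hS, Set.indicator, Set.mem_ofPred_eq, Metric.mem_ball, dist_comm]
  calc _ ≤ ∫⁻ y, ∫⁻ z, F y z ∂θ := lintegral_mono h1
    _ = ∫⁻ z, (∫⁻ y, F y z) ∂θ := lintegral_lintegral_swap hFm.aemeasurable
    _ = ∫⁻ z, C * dampedTerm d s r θ z (k + 1) *
          (2 ^ ((n : ℝ) * k) * volume (Metric.ball (0 : EuclideanSpace ℝ (Fin n)) 1)) ∂θ := by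
        simp_rw [h2]
    _ = _ := by
        rw [lintegral_mul_const _ ((measurable_dampedTerm r θ (k + 1)).const_mul C),
          lintegral_const_mul _ (measurable_dampedTerm r θ (k + 1))]
        ring

/-- As `d > 0` and the mass is finite, the terms decay geometrically at large scales. -/
theorem intTail_ballTerm_ne_top (hd : 0 < d) (hs : 0 < s)
    (θ : Measure (EuclideanSpace ℝ (Fin n))) [IsFiniteMeasure θ] (x : EuclideanSpace ℝ (Fin n))
    (m : ℤ) : intTail (ballTerm d s θ x) m ≠ ∞ := by
  refine ne_top_of_le_ne_top ?_ (intTail_le_tsum_nat _ _)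
  have hle : ∀ j : ℕ, ballTerm d s θ x (m + j) ≤
      (θ Set.univ * 2 ^ (-(d * m))) ^ s * ((2 : ℝ≥0∞) ^ (-(d * s))) ^ j := fun j => by
    rw [← ENNReal.rpow_natCast, ← ENNReal.rpow_mul]
    have h1 : -(d * s) * (j : ℝ) = -(d * j) * s := by ring
    rw [h1, ENNReal.rpow_mul, ← ENNReal.mul_rpow_of_nonneg _ _ hs.le, mul_assoc,
      ← ENNReal.two_rpow_add]
    have h2 : -(d * (m : ℝ)) + -(d * (j : ℝ)) = -(d * ((m + j : ℤ) : ℝ)) := by push_cast; ring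
    rw [h2]
    exact ENNReal.rpow_le_rpow (mul_le_mul_left (measure_mono (Set.subset_univ _)) _) hs.le
  refine ne_top_of_le_ne_top ?_ (ENNReal.tsum_le_tsum hle)
  rw [ENNReal.tsum_mul_left, ENNReal.tsum_geometric]
  refine ENNReal.mul_ne_top (ENNReal.rpow_ne_top_of_nonneg hs.le
    (ENNReal.mul_ne_top (measure_ne_top θ _) (ENNReal.two_rpow_ne_top _))) ?_
  rw [ENNReal.inv_ne_top]
  have : 0 < d * s := by positivity
  exact (tsub_pos_of_lt
    (ENNReal.rpow_lt_one_of_one_lt_of_neg (by norm_num) (by linarith))).ne'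

theorem rpow_ballTerm_eq (hp : 1 < p) (θ : Measure (EuclideanSpace ℝ (Fin n)))
    (y : EuclideanSpace ℝ (Fin n)) (k : ℤ) :
    ballTerm d (1 / (p - 1)) θ y k ^ p = θ (Metric.ball y (2 ^ k)) * 2 ^ (-(d * k)) *
      ballTerm d (1 / (p - 1)) θ y k := by
  have hp' : 0 < p - 1 := sub_pos.2 hp
  have h1 : ballTerm d (1 / (p - 1)) θ y k ^ p = ballTerm d (1 / (p - 1)) θ y k ^ (p - 1) *
      ballTerm d (1 / (p - 1)) θ y k ^ (1 : ℝ) := by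
    rw [← ENNReal.rpow_add_of_nonneg _ _ hp'.le zero_le_one]; congr 1; ring
  rw [h1, ENNReal.rpow_one]
  congr 1
  rw [ballTerm, scaleTerm, ← ENNReal.rpow_mul, one_div_mul_cancel hp'.ne', ENNReal.rpow_one]

theorem isRieszPolar_dyadicWolff_eq_top_of_isFiniteMeasure (hn : 1 ≤ n) (hp : 1 < p)
    (hd : 0 < (n : ℝ) - α * p) (hαn : 0 ≤ (n : ℝ) - α) (θ : Measure (EuclideanSpace ℝ (Fin n)))
    [IsFiniteMeasure θ] :
    IsRieszPolar α p {x | dyadicWolff ((n : ℝ) - α * p) (1 / (p - 1)) θ x = ∞} := by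
  have hp0 : 0 < p := by linarith
  have hs : 0 < 1 / (p - 1) := by have := sub_pos.2 hp; positivity
  set d := (n : ℝ) - α * p with hd_def
  set s := 1 / (p - 1) with hs_def
  -- `δp > 1` makes the test function `p`-integrable, while `δ < 1` keeps its Riesz potential
  -- infinite.
  obtain ⟨δ, hδp, hδ1⟩ : ∃ δ, 1 / p < δ ∧ δ < 1 := exists_between ((div_lt_one hp0).2 hp)
  have hδ0 : 0 < δ := lt_trans (by positivity) hδp
  have hδp' : 1 < δ * p := by rwa [div_lt_iff₀ hp0] at hδp
  have hr0 : 0 ≤ δ * p := by linarith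
  set v := volume (Metric.ball (0 : EuclideanSpace ℝ (Fin n)) 1) with hv
  have hvt : v ≠ ∞ := measure_ball_lt_top.ne
  have hv0 : v ≠ 0 := (Metric.measure_ball_pos volume 0 one_pos).ne'
  set g : ℤ → EuclideanSpace ℝ (Fin n) → ℝ≥0∞ := fun k y =>
    2 ^ (-(α * k)) * dampedTerm d s δ θ y k with hg
  have hgm : ∀ k, Measurable (g k) := fun k => (measurable_dampedTerm δ θ k).const_mul _
  refine ⟨fun y => ⨆ k, g k y, Measurable.iSup hgm, ?_, ?_⟩
  · obtain ⟨C, hC, H⟩ := exists_tsum_mul_one_add_intTail_rpow_le hδp'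
    set C' : ℝ≥0∞ := 2 ^ (d * s) * (2 ^ (d * s)) ^ (δ * p) with hC'
    have hC't : C' ≠ ∞ := ENNReal.mul_ne_top (ENNReal.two_rpow_ne_top _)
      (ENNReal.rpow_ne_top_of_nonneg hr0 (ENNReal.two_rpow_ne_top _))
    have hgp : ∀ k y, g k y ^ p = 2 ^ (-((n : ℝ) * k)) *
        (θ (Metric.ball y (2 ^ k)) * dampedTerm d s (δ * p) θ y k) := fun k y => by
      simp only [hg, dampedTerm]
      rw [ENNReal.mul_rpow_of_nonneg _ _ hp0.le, ENNReal.mul_rpow_of_nonneg _ _ hp0.le,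
        rpow_ballTerm_eq hp, ← ENNReal.rpow_mul, ← ENNReal.rpow_mul]
      have h1 : -((n : ℝ) * k) = -(α * k) * p + -(d * k) := by rw [hd_def]; ring
      rw [h1, ENNReal.two_rpow_add]
      ring
    have hgi : ∀ k, ∫⁻ y, g k y ^ p ≤ C' * v * ∫⁻ z, dampedTerm d s (δ * p) θ z (k + 1) ∂θ :=
      fun k => by
        simp_rw [hgp]
        rw [lintegral_const_mul' _ _ (ENNReal.two_rpow_ne_top _)]
        refine (mul_le_mul_right
          (lintegral_measure_ball_mul_dampedTerm_le hd.le hs.le hr0 θ k) _).trans (le_of_eq ?_)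
        have h1 : (2 : ℝ≥0∞) ^ (-((n : ℝ) * k)) * 2 ^ ((n : ℝ) * k) = 1 := by
          rw [← ENNReal.two_rpow_add]; simp
        rw [← hC', ← hv]
        calc _ = (2 : ℝ≥0∞) ^ (-((n : ℝ) * k)) * 2 ^ ((n : ℝ) * k) * (C' * v *
              ∫⁻ z, dampedTerm d s (δ * p) θ z (k + 1) ∂θ) := by ring
          _ = _ := by rw [h1, one_mul]
    refine ne_top_of_le_ne_top (b := C' * v * (C * θ Set.univ))
      (ENNReal.mul_ne_top (ENNReal.mul_ne_top hC't hvt)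
        (ENNReal.mul_ne_top hC (measure_ne_top θ _))) ?_
    calc ∫⁻ y, (⨆ k, g k y) ^ p ≤ ∫⁻ y, ∑' k, g k y ^ p :=
          lintegral_mono fun y => ENNReal.iSup_rpow_le_tsum_rpow _ hp0
      _ = ∑' k, ∫⁻ y, g k y ^ p :=
          lintegral_tsum fun k => ((hgm k).pow_const p).aemeasurable
      _ ≤ ∑' k : ℤ, C' * v * ∫⁻ z, dampedTerm d s (δ * p) θ z (k + 1) ∂θ :=
          ENNReal.tsum_le_tsum hgi
      _ = C' * v * ∫⁻ z, ∑' k, dampedTerm d s (δ * p) θ z k ∂θ := by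
          rw [ENNReal.tsum_mul_left,
            lintegral_tsum fun k => (measurable_dampedTerm _ θ k).aemeasurable]
          congr 1
          exact (Equiv.addRight (1 : ℤ)).tsum_eq fun k => ∫⁻ z, dampedTerm d s (δ * p) θ z k ∂θ
      _ ≤ C' * v * ∫⁻ _z, C ∂θ :=
          mul_le_mul_right (lintegral_mono fun z => H (ballTerm d s θ z)) _
      _ = _ := by rw [lintegral_const]
  · intro x hx
    set C₃ : ℝ≥0∞ := 2 ^ (d * s) * (2 ^ (d * s)) ^ δ with hC₃
    have hC₃t : C₃ ≠ ∞ := ENNReal.mul_ne_top (ENNReal.two_rpow_ne_top _)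
      (ENNReal.rpow_ne_top_of_nonneg hδ0.le (ENNReal.two_rpow_ne_top _))
    have hC₃0 : C₃ ≠ 0 := mul_ne_zero (ENNReal.two_rpow_ne_zero _)
      (ENNReal.rpow_pos (pos_iff_ne_zero.2 (ENNReal.two_rpow_ne_zero _))
        (ENNReal.two_rpow_ne_top _)).ne'
    set C₄ : ℝ≥0∞ := C₃⁻¹ * (2 ^ (-α) * (v * 2 ^ (-(n : ℝ)))) with hC₄
    have hC₄0 : C₄ ≠ 0 := mul_ne_zero (ENNReal.inv_ne_zero.2 hC₃t) (mul_ne_zero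
      (ENNReal.two_rpow_ne_zero _) (mul_ne_zero hv0 (ENNReal.two_rpow_ne_zero _)))
    -- On the `k`-th annulus the kernel is at least `2^(-(n-α)k)`, the volume at least a multiple of
    -- `2^(nk)`, and `g (k+1)` at least a multiple of `2^(-αk)` times the damped term at `x`; the
    -- powers of two cancel.
    have hann : ∀ k : ℤ, C₄ * dampedTerm d s δ θ x k ≤
        ∫⁻ y in Metric.ball x ((2 : ℝ) ^ k) \ Metric.ball x (2 ^ (k - 1)),
          (⨆ k, g k y) / ENNReal.ofReal (dist x y ^ ((n : ℝ) - α)) := fun k => by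
      have hpt : ∀ y ∈ Metric.ball x ((2 : ℝ) ^ k) \ Metric.ball x (2 ^ (k - 1)),
          2 ^ (-(α * (k + 1 : ℤ))) * (C₃⁻¹ * dampedTerm d s δ θ x k) *
            2 ^ (-(((n : ℝ) - α) * k)) ≤
          (⨆ k, g k y) / ENNReal.ofReal (dist x y ^ ((n : ℝ) - α)) := fun y hy => by
        have hdist : dist x y ≤ 2 ^ k := by rw [dist_comm]; exact (Metric.mem_ball.1 hy.1).le
        rw [div_eq_mul_inv, ENNReal.rpow_neg _ (((n : ℝ) - α) * k),
          ← ENNReal.ofReal_two_zpow_rpow]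
        refine mul_le_mul' ?_ (ENNReal.inv_le_inv.2 (ENNReal.ofReal_le_ofReal
          (Real.rpow_le_rpow dist_nonneg hdist hαn)))
        refine le_trans ?_ (le_iSup (fun k => g k y) (k + 1))
        refine mul_le_mul_right ?_ _
        calc C₃⁻¹ * dampedTerm d s δ θ x k ≤ C₃⁻¹ * (C₃ * dampedTerm d s δ θ y (k + 1)) :=
              mul_le_mul_right (dampedTerm_le hd.le hs.le hδ0.le θ hy.1) _
          _ = _ := by rw [← mul_assoc, ENNReal.inv_mul_cancel hC₃0 hC₃t, one_mul]
      refine le_trans ?_ (setLIntegral_mono' (Metric.isOpen_ball.measurableSet.diff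
        Metric.isOpen_ball.measurableSet) hpt)
      rw [setLIntegral_const]
      refine le_trans (le_of_eq ?_) (mul_le_mul_right (volume_ball_le_volume_annulus hn x k) _)
      rw [volume_ball_two_zpow, ← hv, hC₄]
      have h1 : (2 : ℝ≥0∞) ^ (-α) * 2 ^ (-(n : ℝ)) = 2 ^ (-(α * (k + 1 : ℤ))) *
          2 ^ (-(((n : ℝ) - α) * k)) * 2 ^ ((n : ℝ) * (k - 1 : ℤ)) := by
        rw [← ENNReal.two_rpow_add, ← ENNReal.two_rpow_add, ← ENNReal.two_rpow_add]
        congr 1; push_cast; ring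
      calc _ = C₃⁻¹ * v * dampedTerm d s δ θ x k * ((2 : ℝ≥0∞) ^ (-α) * 2 ^ (-(n : ℝ))) := by ring
        _ = _ := by rw [h1]; ring
    have htop : ∑' k, dampedTerm d s δ θ x k = ∞ :=
      tsum_mul_one_add_intTail_rpow_eq_top (ballTerm d s θ x) hx
        (intTail_ballTerm_ne_top hd hs θ x) hδ0 hδ1
    refine top_unique ?_
    calc ∞ = ∑' k, C₄ * dampedTerm d s δ θ x k := by
          rw [ENNReal.tsum_mul_left, htop, ENNReal.mul_top hC₄0]
      _ ≤ _ := ENNReal.tsum_le_tsum hann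
      _ ≤ _ := tsum_setLIntegral_annulus_le x _

/-- A finite value at `x₀` bounds the tails there, so any infinite value comes from the restriction
of `θ` to some ball about `x₀`; these restrictions are finite. -/
theorem isRieszPolar_dyadicWolff_eq_top (hn : 1 ≤ n) (hp : 1 < p)
    (hd : 0 < (n : ℝ) - α * p) (hαn : 0 ≤ (n : ℝ) - α) (θ : Measure (EuclideanSpace ℝ (Fin n)))
    {x₀ : EuclideanSpace ℝ (Fin n)}
    (hx₀ : dyadicWolff ((n : ℝ) - α * p) (1 / (p - 1)) θ x₀ ≠ ∞) :
    IsRieszPolar α p {x | dyadicWolff ((n : ℝ) - α * p) (1 / (p - 1)) θ x = ∞} := by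
  have hs : 0 < 1 / (p - 1) := by have := sub_pos.2 hp; positivity
  refine IsRieszPolar.mono ?_ (IsRieszPolar.iUnion (by linarith : 0 < p) fun m : ℕ => ?_)
    (A := _) (B := ⋃ m : ℕ, {x | dyadicWolff ((n : ℝ) - α * p) (1 / (p - 1))
      (θ.restrict (Metric.ball x₀ (2 ^ ((m : ℤ) + 1)))) x = ∞})
  · intro y hy
    obtain ⟨m, hm⟩ := pow_unbounded_of_one_lt (dist y x₀) one_lt_two
    have hm' : dist y x₀ < 2 ^ (m : ℤ) := by simpa using hm
    refine Set.mem_iUnion.2 ⟨m, ?_⟩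
    have h := dyadicWolff_le_restrict_add (d := (n : ℝ) - α * p) hs.le (ν := θ) hm'
    rw [show dyadicWolff ((n : ℝ) - α * p) (1 / (p - 1)) θ y = ∞ from hy, top_le_iff,
      ENNReal.add_eq_top] at h
    refine h.resolve_right (ENNReal.mul_ne_top (ENNReal.two_rpow_ne_top _) ?_)
    exact ne_top_of_le_ne_top hx₀ (intTail_le_tsum _ _)
  · have : IsFiniteMeasure (θ.restrict (Metric.ball x₀ ((2 : ℝ) ^ ((m : ℤ) + 1)))) :=
      ⟨by rw [Measure.restrict_apply_univ]
          exact (measure_ball_ne_top_of_dyadicWolff_ne_top hs hx₀ _).lt_top⟩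
    exact isRieszPolar_dyadicWolff_eq_top_of_isFiniteMeasure hn hp hd hαn _

end Capacity

/-! ### The quasi-everywhere bound and the final assembly. -/

theorem IsWolffSolution.quasiEverywhere_le {n : ℕ} {p α q : ℝ} (hn : 1 ≤ n) (hp : 1 < p)
    (hd : 0 < (n : ℝ) - α * p) (hαn : 0 ≤ (n : ℝ) - α) {C : ℝ≥0∞} (hC : C ≠ 0)
    {σ μ : Measure (EuclideanSpace ℝ (Fin n))} {u : EuclideanSpace ℝ (Fin n) → ℝ≥0∞}
    (hu : IsWolffSolution α p q σ μ u)
    (hle : ∀ x, u x < ∞ → u x ≤ C * wolffBound α p q σ μ x) :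
    QuasiEverywhere α p fun x => u x ≤ C * wolffBound α p q σ μ x := by
  have hp0 : 0 < p := by linarith
  have hs : 0 < 1 / (p - 1) := by have := sub_pos.2 hp; positivity
  refine IsRieszPolar.rieszCapacity_eq_zero hp0 ?_
  by_cases h : ∃ x₀, u x₀ < ∞
  · obtain ⟨x₀, hx₀⟩ := h
    set ω := σ.withDensity fun y => u y ^ q with hω
    rw [hu.eq_rhs] at hx₀
    have hDω := ne_top_of_le_ne_top (ENNReal.mul_ne_top (ENNReal.two_rpow_ne_top _)
      (lt_of_le_of_lt le_self_add hx₀).ne) (dyadicWolff_le_wolffPotential hp hd ω x₀)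
    have hDμ := ne_top_of_le_ne_top (ENNReal.mul_ne_top (ENNReal.two_rpow_ne_top _)
      (lt_of_le_of_lt le_add_self hx₀).ne) (dyadicWolff_le_wolffPotential hp hd μ x₀)
    have hDθ : dyadicWolff ((n : ℝ) - α * p) (1 / (p - 1)) (ω + μ) x₀ ≠ ∞ :=
      ne_top_of_le_ne_top (ENNReal.mul_ne_top (ENNReal.two_rpow_ne_top _)
        (ENNReal.add_ne_top.2 ⟨hDω, hDμ⟩)) (dyadicWolff_add_le hs.le ω μ x₀)
    refine (isRieszPolar_dyadicWolff_eq_top hn hp hd hαn (ω + μ) hDθ).mono fun x hx => ?_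
    by_contra hfin
    have hfin' : dyadicWolff ((n : ℝ) - α * p) (1 / (p - 1)) (ω + μ) x ≠ ∞ := hfin
    refine hx (hle x ?_)
    rw [hu.eq_rhs]
    refine ENNReal.add_lt_top.2 ⟨?_, ?_⟩
    · refine (wolffPotential_le_dyadicWolff hp hd ω x).trans_lt (ENNReal.mul_lt_top
        (ENNReal.two_rpow_ne_top _).lt_top (lt_of_le_of_lt ?_ hfin'.lt_top))
      exact dyadicWolff_mono hs.le (Measure.le_add_right le_rfl) x
    · refine (wolffPotential_le_dyadicWolff hp hd μ x).trans_lt (ENNReal.mul_lt_top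
        (ENNReal.two_rpow_ne_top _).lt_top (lt_of_le_of_lt ?_ hfin'.lt_top))
      exact dyadicWolff_mono hs.le (Measure.le_add_left le_rfl) x
  -- If `u = ∞` everywhere then `σ = 0`, so `Wμ = u = ∞` and the right-hand side is infinite too:
  -- the exceptional set is empty.
  · push Not at h
    have hσ : σ = 0 := by
      have : ∀ᵐ x ∂σ, False := by
        filter_upwards [hu.ae_finite] with x hx
        exact absurd (h x) (not_le.2 hx)
      rwa [Filter.eventually_false_iff_eq_bot, ae_eq_bot] at this
    refine ⟨fun _ => 0, measurable_const, by simp [hp0], fun x hx => absurd ?_ hx⟩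
    have hx' := h x
    rw [hu.eq_rhs, wolffRHS, hσ, withDensity_zero_left, wolffPotential_zero hp, zero_add,
      top_le_iff] at hx'
    have hB : wolffBound α p q σ μ x = ∞ := by rw [wolffBound, hx', add_top]
    simp only [hB, ENNReal.mul_top hC, le_top]

theorem theorem4p1 (n : ℕ) (p α q : ℝ) (hp : 1 < p) (hα : 0 < α) (hαn : α < (n : ℝ) / p)
    (hq : 0 < q) (hqp : q < p - 1) :
    ∃ C₁ C₂ : ℝ, 0 < C₁ ∧ 0 < C₂ ∧
      ∀ (σ μ : Measure (EuclideanSpace ℝ (Fin n)))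
        [IsLocallyFiniteMeasure σ] [IsLocallyFiniteMeasure μ]
        (u : EuclideanSpace ℝ (Fin n) → ℝ≥0∞),
        (IsWolffSolution α p q σ μ u →
          ((μ ≠ 0 ∨ ¬ (∀ᵐ x ∂σ, u x = 0)) →
            ∀ x, ENNReal.ofReal C₁ * wolffBound α p q σ μ x ≤ u x) ∧
          (∀ x, u x < ∞ → u x ≤ ENNReal.ofReal C₂ * wolffBound α p q σ μ x) ∧
          (∀ᵐ x ∂σ, u x ≤ ENNReal.ofReal C₂ * wolffBound α p q σ μ x) ∧
          QuasiEverywhere α p fun x => u x ≤ ENNReal.ofReal C₂ * wolffBound α p q σ μ x) ∧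
        (IsWolffSupersolution α p q σ μ u → (μ ≠ 0 ∨ ¬ (∀ᵐ x ∂σ, u x = 0)) →
          ∀ x, wolffRHS α p q σ μ u x ≤ u x → u x < ∞ →
            ENNReal.ofReal C₁ * wolffBound α p q σ μ x ≤ u x) ∧
        (IsWolffSubsolution α p q σ μ u →
          ∀ x, u x ≤ wolffRHS α p q σ μ u x → wolffRHS α p q σ μ u x < ∞ →
            u x ≤ ENNReal.ofReal C₂ * wolffBound α p q σ μ x) := by
  have hp0 : 0 < p := by linarith
  have hd : 0 < (n : ℝ) - α * p := by rw [lt_div_iff₀ hp0] at hαn; linarith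
  have hαn' : 0 < (n : ℝ) - α := by nlinarith
  have hn : 1 ≤ n := by
    have : (0 : ℝ) < n := by linarith
    exact_mod_cast this
  obtain ⟨K₁, hK₁, HL⟩ := exists_wolffBound_le n hp hd hq hqp
  obtain ⟨K₂, hK₂, HU⟩ := exists_wolffRHS_le n hp hd hq hqp
  -- Adding 1 to each constant makes it nonzero, so that both become positive reals.
  have hK₁' : K₁ + 1 ≠ ∞ := by simp [hK₁]
  have hK₁0 : 0 < (K₁ + 1).toReal := ENNReal.toReal_pos (by simp) hK₁'
  have hC₁ : ENNReal.ofReal ((K₁ + 1).toReal⁻¹) = (K₁ + 1)⁻¹ := by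
    rw [ENNReal.ofReal_inv_of_pos hK₁0, ENNReal.ofReal_toReal hK₁']
  have hC₂ : ENNReal.ofReal (K₂.toReal + 1) = K₂ + 1 := by
    rw [ENNReal.ofReal_add ENNReal.toReal_nonneg zero_le_one, ENNReal.ofReal_toReal hK₂,
      ENNReal.ofReal_one]
  refine ⟨(K₁ + 1).toReal⁻¹, K₂.toReal + 1, inv_pos.2 hK₁0, by positivity, ?_⟩
  intro σ μ _ _ u
  rw [hC₁, hC₂]
  have lower : AEMeasurable u σ → (∀ᵐ y ∂σ, wolffRHS α p q σ μ u y ≤ u y) →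
      (μ ≠ 0 ∨ ¬ ∀ᵐ y ∂σ, u y = 0) → ∀ x, wolffRHS α p q σ μ u x ≤ u x → u x < ∞ →
      (K₁ + 1)⁻¹ * wolffBound α p q σ μ x ≤ u x := fun hm hsup hnt x hx hxt => by
    have h1 := HL σ μ u hm hsup hnt x (hx.trans_lt hxt)
    calc (K₁ + 1)⁻¹ * wolffBound α p q σ μ x ≤ (K₁ + 1)⁻¹ * ((K₁ + 1) * u x) := by
          refine mul_le_mul_right (h1.trans ?_) _
          exact mul_le_mul' le_self_add hx
      _ = u x := by rw [← mul_assoc, ENNReal.inv_mul_cancel (by simp) hK₁', one_mul]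
  have upper : (∀ᵐ y ∂σ, u y ≤ wolffRHS α p q σ μ u y) → ∀ x,
      u x ≤ wolffRHS α p q σ μ u x → wolffRHS α p q σ μ u x < ∞ →
      u x ≤ (K₂ + 1) * wolffBound α p q σ μ x := fun hsub x hx hxt =>
    (hx.trans (HU σ μ u hsub x hxt)).trans (mul_le_mul_left le_self_add _)
  refine ⟨fun hu => ?_, fun hu hnt => lower hu.aemeasurable hu.ae_rhs_le hnt,
    fun hu => upper hu.ae_le_rhs⟩
  have hfin : ∀ x, u x < ∞ → u x ≤ (K₂ + 1) * wolffBound α p q σ μ x := fun x hx =>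
    upper (Filter.Eventually.of_forall fun y => (hu.eq_rhs y).le) x (hu.eq_rhs x).le
      (by rwa [← hu.eq_rhs x])
  refine ⟨fun hnt x => ?_, hfin, ?_, hu.quasiEverywhere_le hn hp hd hαn'.le (by simp) hfin⟩
  · rcases eq_or_ne (u x) ∞ with h | h
    · rw [h]; exact le_top
    · exact lower hu.aemeasurable (Filter.Eventually.of_forall fun y => (hu.eq_rhs y).ge) hnt x
        (hu.eq_rhs x).ge h.lt_top
  · filter_upwards [hu.ae_finite] with x hx
    exact hfin x hx
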